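/- Let $V$ be a finite-dimensional real inner product space with inner product $\beta$ and orthonormal basis $(a_i)$, $n=\dim V$, regarded as a purely odd super vector space. Let $\mathfrak{hc}=V\oplus\mathbb R z$ be the Heisenberg--Clifford Lie superalgebra: the even element $z$ is central and $[v,w]=2\beta(v,w)z$ for $v,w\in V$. Let $\mathfrak U(\mathfrak{hc})$ be its enveloping algebra (so $a_i^2=z$ and $a_ia_j=-a_ja_i$ for $i\ne j$), with coproduct $\Delta$, and let $\gamma=a_1\cdots a_n$ be the product of the basis vectors in order. *Functions.* A smooth function $F$ on the supergroup $HC=(\mathbb R,\mathfrak{hc})$ is a real-linear map $F:\mathfrak U(\mathfrak{hc})\to C^\infty(\mathbb R,\mathbb C)$ with $F(zu)=F(u)'$ for all $u$; we write $F(u;x)=F(u)(x)$. Functions with values in a finite-dimensional complex vector space are defined in the same way. For an even vector-valued $G$, the product is $F\cdot G=\mu\circ(F\otimes G)\circ\Delta$, where $\mu$ is pointwise multiplication and $(F\otimes G)(p\otimes q)=F(p)\otimes G(q)$. The integral is $\int_{HC}F=\int_{\mathbb R}F(\gamma;x)\,dx$. For $a>0$ let $\mathcal C^\infty_{[-a,a]}(HC)$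 be the space of smooth functions $F$ on $HC$ with $\operatorname{supp}F(u)\subset[-a,a]$ for all $u\in\mathfrak U(\mathfrak{hc})$. *Spin representations.* Let $\zeta\in\mathbb C$. If $n=2k$, let $\mathcal S=(\mathbb C^{1|1})^{\otimes k}$ and $\mathcal H_\zeta=\operatorname{End}(\mathcal S)$. Let $c_\zeta$ be the $k$-fold super tensor product of the representation on $\mathbb C^{1|1}$ given by $a_1\mapsto\begin{pmatrix}0&\zeta\\1&0\end{pmatrix}$, $a_2\mapsto\begin{pmatrix}0&i\zeta\\-i&0\end{pmatrix}$, the $j$-th factor taking the $j$-th consecutive pair of basis vectors. Let $T$ be the supertrace. If $n=2k+1$, number the basis $a_0,\dots,a_{2k}$, let $D=\mathbb C[\epsilon]$ with $\epsilon^2=\zeta$, $\mathcal S=D\otimes_{\mathbb C}\mathbb C^{2^k}$, and let $\mathcal H_\zeta=\operatorname{End}_D(\mathcal S)$ be the algebra of $D$-linear endomorphisms. Put $x_0=\epsilon\otimes 1$ and $x_j=1\otimes c_1(a_j)$ for $1\le j\le 2k$, where $c_1$ is the above representation for dimension $2k$ and parameter $1$, applied to $a_1,\dots,a_{2k}$.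 Set $c_\zeta(a_0)=i^kx_0x_1\cdots x_{2k}$ and $c_\zeta(a_j)=-i\,c_\zeta(a_0)x_j$ for $j\geq1$. Let $T(A)=\operatorname{Tr}(e^{i\pi/4}\epsilon A)$, the trace being taken over $\mathbb C$. In both cases, $d\pi_\zeta$ is the representation of $\mathfrak U(\mathfrak{hc})$ on $\mathcal S$ with $d\pi_\zeta(v)=e^{i\pi/4}c_\zeta(v)$ for $v\in V$ and $d\pi_\zeta(z)=i\zeta$, and $\pi_\zeta$ is the even $\mathcal H_\zeta$-valued function on $HC$ with $\pi_\zeta(u;x)=e^{i\zeta x}d\pi_\zeta(u)$. Put $[n]=n/2$ for even $n$ and $[n]=(n+1)/2$ for odd $n$. *Exponential type.* For odd $n$ use the basis of $\mathcal S$ obtained from the basis $1,\epsilon$ of $D$ and the standard basis of $\mathbb C^{2^k}$, so that all $\mathcal H_\zeta$ consist of matrices of one fixed size. An entire function $A:\mathbb C\to\mathcal H$ is a matrix-valued function with entire entries such that $A(\zeta)\in\mathcal H_{-\zeta}$ for all $\zeta$. It is of exponential type $a$ if for every $u\in\mathfrak U(\mathfrak{hc})$ and every $N\in\mathbb N$ there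 is a constant $C_{N,u}$ such that $$\bigl|\zeta^{-[n]}\,T\bigl(A(\zeta)\,d\pi_{-\zeta}(u)\bigr)\bigr|\le C_{N,u}\,(1+|\zeta|)^{-N}e^{a|\operatorname{Im}\zeta|}\qquad\text{for all }\zeta\in\mathbb C\setminus\{0\},$$ where $T$ is taken on $\mathcal H_{-\zeta}$. **Theorem.** For every $a>0$, the Fourier--Laplace transform $F\mapsto\widehat F$, $\widehat F(\zeta)=\int_{HC}F\cdot\pi_{-\zeta}$, is a bijection from $\mathcal C^\infty_{[-a,a]}(HC)$ onto the set of entire functions $A:\mathbb C\to\mathcal H$ of exponential type $a$. -/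

import Mathlib

open scoped TensorProduct ContDiff

noncomputable section

namespace HeisenbergClifford

/-! ## The Heisenberg--Clifford Lie superalgebra and its enveloping algebra -/

section Enveloping

variable (V : Type*) [NormedAddCommGroup V] [InnerProductSpace ℝ V]

/-- The Lie superalgebra `hc(V) = V ⊕ ℝ z` of a purely odd Euclidean space `V`: the odd part is
`V`, the even part is the centre `ℝ z`, and `β` is the inner product of `V`. -/
abbrev HC := V × ℝ

/-- The superbracket `[u + s z, v + t z] = 2 β(u, v) z`. -/
def bracket (x y : HC V) : HC V := (0, 2 * inner ℝ x.1 y.1)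

/-- The defining relations of the enveloping algebra:
`x y - (-1)^{|x| |y|} y x = [x, y]` for homogeneous `x`, `y`. -/
inductive EnvRel : TensorAlgebra ℝ (HC V) → TensorAlgebra ℝ (HC V) → Prop
  | odd_odd (v w : V) :
      EnvRel (TensorAlgebra.ι ℝ ((v, 0) : HC V) * TensorAlgebra.ι ℝ ((w, 0) : HC V)
          + TensorAlgebra.ι ℝ ((w, 0) : HC V) * TensorAlgebra.ι ℝ ((v, 0) : HC V))
        (TensorAlgebra.ι ℝ (bracket V (v, 0) (w, 0)))
  | even_any (t : ℝ) (x : HC V) :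
      EnvRel (TensorAlgebra.ι ℝ ((0, t) : HC V) * TensorAlgebra.ι ℝ x
          - TensorAlgebra.ι ℝ x * TensorAlgebra.ι ℝ ((0, t) : HC V))
        (TensorAlgebra.ι ℝ (bracket V (0, t) x))

/-- The universal enveloping (super)algebra `U(hc)`. -/
def Env := RingQuot (EnvRel V)

instance : Ring (Env V) := inferInstanceAs (Ring (RingQuot (EnvRel V)))

instance : Algebra ℝ (Env V) := inferInstanceAs (Algebra ℝ (RingQuot (EnvRel V)))

variable {V}

/-- The canonical map `hc → U(hc)`. -/
def ι : HC V →ₗ[ℝ] Env V :=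
  (RingQuot.mkAlgHom ℝ (EnvRel V)).toLinearMap ∘ₗ TensorAlgebra.ι ℝ

/-- The central element `z`, in `U(hc)`. -/
def zElt : Env V := ι (0, 1)

theorem ι_odd_odd (v w : V) :
    (ι (v, 0) * ι (w, 0) + ι (w, 0) * ι (v, 0) : Env V) = ι (0, 2 * inner ℝ v w) := by
  have h := RingQuot.mkAlgHom_rel ℝ (EnvRel.odd_odd v w)
  rw [map_add, map_mul, map_mul] at h
  exact h

theorem ι_even_comm (t : ℝ) (x : HC V) : (ι (0, t) * ι x : Env V) = ι x * ι (0, t) := by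
  have h := RingQuot.mkAlgHom_rel ℝ (EnvRel.even_any t x)
  have h0 : bracket V (0, t) x = 0 := by simp [bracket]
  rw [h0, map_zero, map_zero, map_sub, map_mul, map_mul, sub_eq_zero] at h
  exact h

/-- The universal property of `U(hc)`. -/
def lift {A : Type*} [Ring A] [Algebra ℝ A] (f : HC V →ₗ[ℝ] A)
    (hodd : ∀ v w : V, f (v, 0) * f (w, 0) + f (w, 0) * f (v, 0) = f (0, 2 * inner ℝ v w))
    (heven : ∀ (t : ℝ) (x : HC V), f (0, t) * f x = f x * f (0, t)) : Env V →ₐ[ℝ] A :=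
  RingQuot.liftAlgHom ℝ ⟨TensorAlgebra.lift ℝ f, by
    intro p q h
    cases h with
    | odd_odd v w => simpa [bracket] using hodd v w
    | even_any t x =>
      have h0 : bracket V (0, t) x = 0 := by simp [bracket]
      simp [h0, heven t x]⟩

theorem lift_ι {A : Type*} [Ring A] [Algebra ℝ A] (f : HC V →ₗ[ℝ] A)
    (hodd : ∀ v w : V, f (v, 0) * f (w, 0) + f (w, 0) * f (v, 0) = f (0, 2 * inner ℝ v w))
    (heven : ∀ (t : ℝ) (x : HC V), f (0, t) * f x = f x * f (0, t)) (x : HC V) :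
    lift f hodd heven (ι x) = f x := by
  have h := RingQuot.liftAlgHom_mkAlgHom_apply (S := ℝ) (f := TensorAlgebra.lift ℝ f)
    (s := EnvRel V) (w := by
      intro p q h
      cases h with
      | odd_odd v w => simpa [bracket] using hodd v w
      | even_any t x =>
        have h0 : bracket V (0, t) x = 0 := by simp [bracket]
        simp [h0, heven t x]) (x := TensorAlgebra.ι ℝ x)
  rw [TensorAlgebra.lift_ι_apply] at h
  exact h

/-- The parity automorphism `u ↦ (-1)^{|u|} u` of `U(hc)`. -/
def parity : Env V →ₐ[ℝ] Env V :=
  lift (ι ∘ₗ LinearMap.prodMap (-LinearMap.id) LinearMap.id)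
    (by
      intro v w
      have h := ι_odd_odd (-v) (-w)
      simpa using h)
    (by
      intro t x
      have h := ι_even_comm t ((-x.1, x.2) : HC V)
      simpa using h)

theorem parity_odd (v : V) : parity (ι (v, 0)) = -(ι (v, 0) : Env V) := by
  rw [parity, lift_ι, ← map_neg]
  simp

theorem parity_even (t : ℝ) : parity (ι (0, t)) = (ι (0, t) : Env V) := by
  rw [parity, lift_ι]
  simp

theorem parity_parity (u : Env V) : parity (parity u) = u := by
  have h : (parity.comp parity : Env V →ₐ[ℝ] Env V) = AlgHom.id ℝ (Env V) := by
    apply RingQuot.ringQuot_ext'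
    apply TensorAlgebra.hom_ext
    ext x
    · change parity (parity (ι (x, 0))) = ι (x, 0)
      rw [parity_odd, map_neg, parity_odd, neg_neg]
    · change parity (parity (ι (0, 1))) = ι (0, 1)
      rw [parity_even, parity_even]
  exact DFunLike.congr_fun h u

/-- For `x = v + t z` in `hc`, left multiplication by `x ⊗ 1 + 1 ⊗ x` in the super tensor product
`U(hc) ⊗ U(hc)`, where `(1 ⊗ v) (p ⊗ q) = (-1)^{|p|} p ⊗ v q` and `(1 ⊗ z) (p ⊗ q) = p ⊗ z q`. -/
def coprodAux : HC V →ₗ[ℝ] Module.End ℝ (Env V ⊗[ℝ] Env V) where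
  toFun x := TensorProduct.map (LinearMap.mulLeft ℝ (ι x)) LinearMap.id
    + TensorProduct.map parity.toLinearMap (LinearMap.mulLeft ℝ (ι (x.1, 0)))
    + TensorProduct.map LinearMap.id (LinearMap.mulLeft ℝ (ι (0, x.2)))
  map_add' x y := by
    have h1 : ((x + y).1, (0 : ℝ)) = (x.1, 0) + (y.1, 0) := by simp
    have h2 : ((0 : V), (x + y).2) = (0, x.2) + (0, y.2) := by simp
    ext p q
    simp only [h1, h2, map_add]
    simp [add_mul, TensorProduct.add_tmul, TensorProduct.tmul_add]
    abel
  map_smul' c x := by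
    have h1 : ((c • x).1, (0 : ℝ)) = c • (x.1, 0) := by simp
    have h2 : ((0 : V), (c • x).2) = c • (0, x.2) := by simp
    ext p q
    simp only [h1, h2, map_smul]
    simp [TensorProduct.smul_tmul']

theorem coprodAux_odd (v : V) (p q : Env V) :
    coprodAux (v, 0) (p ⊗ₜ[ℝ] q) = (ι (v, 0) * p) ⊗ₜ q + parity p ⊗ₜ (ι (v, 0) * q) := by
  have h : (ι ((0, 0) : HC V) : Env V) = 0 := by
    rw [← Prod.zero_eq_mk, map_zero]
  simp [coprodAux, h]

theorem coprodAux_even (t : ℝ) (p q : Env V) :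
    coprodAux (0, t) (p ⊗ₜ[ℝ] q) = (ι (0, t) * p) ⊗ₜ q + p ⊗ₜ (ι (0, t) * q) := by
  have h : (ι ((0, 0) : HC V) : Env V) = 0 := by
    rw [← Prod.zero_eq_mk, map_zero]
  simp [coprodAux, h]

/-- Left multiplication by `Δ(u)` in the super tensor product `U(hc) ⊗ U(hc)`: the unique algebra
homomorphism that is multiplication by `x ⊗ 1 + 1 ⊗ x` for `u = x ∈ hc`. -/
def coprodMul : Env V →ₐ[ℝ] Module.End ℝ (Env V ⊗[ℝ] Env V) :=
  lift coprodAux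
    (by
      intro v w
      ext p q
      simp only [TensorProduct.AlgebraTensorModule.curry_apply, TensorProduct.curry_apply,
        LinearMap.restrictScalars_self, LinearMap.add_apply, Module.End.mul_apply,
        coprodAux_odd, coprodAux_even, map_add, map_mul, parity_odd, parity_parity,
        ← ι_odd_odd v w, ← mul_assoc, add_mul, TensorProduct.add_tmul, TensorProduct.tmul_add,
        neg_mul, TensorProduct.neg_tmul]
      abel)
    (by
      intro t x
      have hx : x = (x.1, 0) + (0, x.2) := by simp
      rw [hx, map_add, mul_add, add_mul]
      congr 1
      · ext p q
        simp only [TensorProduct.AlgebraTensorModule.curry_apply, TensorProduct.curry_apply,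
          LinearMap.restrictScalars_self, Module.End.mul_apply,
          coprodAux_odd, coprodAux_even, map_add, map_mul, parity_even,
          ← mul_assoc, ι_even_comm t]
        abel
      · ext p q
        simp only [TensorProduct.AlgebraTensorModule.curry_apply, TensorProduct.curry_apply,
          LinearMap.restrictScalars_self, Module.End.mul_apply,
          coprodAux_even, map_add, ← mul_assoc, ι_even_comm t]
        abel)

/-- The coproduct `Δ : U(hc) → U(hc) ⊗ U(hc)`. -/
def coprod (u : Env V) : Env V ⊗[ℝ] Env V := coprodMul u (1 ⊗ₜ 1)

theorem coprodMul_z (t : Env V ⊗[ℝ] Env V) :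
    coprodMul zElt t = TensorProduct.map (LinearMap.mulLeft ℝ zElt) LinearMap.id t
      + TensorProduct.map LinearMap.id (LinearMap.mulLeft ℝ zElt) t := by
  induction t with
  | zero => simp
  | tmul p q =>
    rw [coprodMul, zElt, lift_ι, coprodAux_even]
    simp
  | add s t hs ht =>
    simp only [map_add, hs, ht]
    abel

theorem coprod_z_mul (u : Env V) :
    coprod (zElt * u) = TensorProduct.map (LinearMap.mulLeft ℝ zElt) LinearMap.id (coprod u)
      + TensorProduct.map LinearMap.id (LinearMap.mulLeft ℝ zElt) (coprod u) := by
  rw [← coprodMul_z, coprod, coprod, map_mul, Module.End.mul_apply]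

/-- `γ = a₁ ⋯ aₙ` for an orthonormal basis `a`. -/
def gammaElt {n : ℕ} (b : OrthonormalBasis (Fin n) ℝ V) : Env V :=
  (List.ofFn fun i => (ι (b i, 0) : Env V)).prod

end Enveloping

/-! ## Smooth functions on the supergroup -/

section Smooth

variable (V : Type*) [NormedAddCommGroup V] [InnerProductSpace ℝ V]
variable (W : Type*) [NormedAddCommGroup W] [NormedSpace ℝ W]

/-- Smooth `W`-valued functions on the Heisenberg--Clifford supergroup `(ℝ, hc)`: linear maps
`F : U(hc) → C^∞(ℝ, W)` that intertwine the action of the even part `ℝ z` of `hc`, where `z` acts on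
`C^∞(ℝ, W)` as the derivative.  We write `F(u; x)` for `F.toFun u x`. -/
@[ext]
structure SmoothFn where
  toFun : Env V →ₗ[ℝ] (ℝ → W)
  smooth : ∀ u, ContDiff ℝ ∞ (toFun u)
  z_mul : ∀ u, toFun (zElt * u) = deriv (toFun u)

variable {V W}

/-- The linear map `p ⊗ q ↦ F(p) G(q)`, i.e. `μ ∘ (F ⊗ G)`, for even `G`. -/
def pairMap [NormedSpace ℂ W] [IsScalarTower ℝ ℂ W] (F : SmoothFn V ℂ) (G : SmoothFn V W) :
    Env V ⊗[ℝ] Env V →ₗ[ℝ] (ℝ → W) :=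
  TensorProduct.lift (LinearMap.mk₂ ℝ (fun p q x => F.toFun p x • G.toFun q x)
    (by intro p p' q; funext x; simp [add_smul])
    (by
      intro c p q; funext x
      have h : F.toFun (c • p) x = c • F.toFun p x := by rw [map_smul, Pi.smul_apply]
      rw [h, Pi.smul_apply, smul_assoc])
    (by intro p q q'; funext x; simp)
    (by
      intro c p q; funext x
      have : SMulCommClass ℝ ℂ W := IsScalarTower.to_smulCommClass
      have h : G.toFun (c • q) x = c • G.toFun q x := by rw [map_smul, Pi.smul_apply]
      rw [h, Pi.smul_apply, smul_comm]))

theorem pairMap_tmul [NormedSpace ℂ W] [IsScalarTower ℝ ℂ W] (F : SmoothFn V ℂ)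
    (G : SmoothFn V W) (p q : Env V) (x : ℝ) :
    pairMap F G (p ⊗ₜ q) x = F.toFun p x • G.toFun q x := rfl

theorem pairMap_smooth [NormedSpace ℂ W] [IsScalarTower ℝ ℂ W] (F : SmoothFn V ℂ)
    (G : SmoothFn V W) (t : Env V ⊗[ℝ] Env V) : ContDiff ℝ ∞ (pairMap F G t) := by
  induction t with
  | zero => rw [map_zero]; exact contDiff_const
  | tmul p q => exact (F.smooth p).smul (G.smooth q)
  | add s t hs ht => rw [map_add]; exact hs.add ht

theorem pairMap_deriv [NormedSpace ℂ W] [IsScalarTower ℝ ℂ W] (F : SmoothFn V ℂ)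
    (G : SmoothFn V W) (t : Env V ⊗[ℝ] Env V) :
    pairMap F G (TensorProduct.map (LinearMap.mulLeft ℝ zElt) LinearMap.id t
      + TensorProduct.map LinearMap.id (LinearMap.mulLeft ℝ zElt) t)
      = deriv (pairMap F G t) := by
  have hone : (∞ : WithTop ℕ∞) ≠ 0 := by simp
  induction t with
  | zero =>
    funext x
    simp only [map_zero, add_zero]
    exact (deriv_const x (0 : W)).symm
  | tmul p q =>
    funext x
    have hF := ((F.smooth p).differentiable hone x).hasDerivAt
    have hG := ((G.smooth q).differentiable hone x).hasDerivAt
    have h := (hF.smul hG).deriv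
    rw [show deriv (pairMap F G (p ⊗ₜ q)) x = deriv (F.toFun p • G.toFun q) x from rfl, h]
    simp only [TensorProduct.map_tmul, LinearMap.mulLeft_apply, LinearMap.id_apply, map_add,
      Pi.add_apply, pairMap_tmul, F.z_mul, G.z_mul]
    abel
  | add s t hs ht =>
    funext x
    have hs' := (pairMap_smooth F G s).differentiable hone x
    have ht' := (pairMap_smooth F G t).differentiable hone x
    rw [map_add (pairMap F G) s t, deriv_add hs' ht', ← hs, ← ht]
    simp only [map_add, Pi.add_apply]
    abel

/-- The product `F · G = μ ∘ (F ⊗ G) ∘ Δ` of a smooth function `F` with an even `W`-valued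
function `G`; since `G` is even, `(F ⊗ G)(p ⊗ q) = F(p) G(q)` without a sign. -/
def mulEven [NormedSpace ℂ W] [IsScalarTower ℝ ℂ W] (F : SmoothFn V ℂ) (G : SmoothFn V W) :
    SmoothFn V W where
  toFun := pairMap F G ∘ₗ (LinearMap.applyₗ (1 ⊗ₜ 1) ∘ₗ coprodMul.toLinearMap)
  smooth u := pairMap_smooth F G (coprod u)
  z_mul u := by
    have h := pairMap_deriv F G (coprod u)
    rw [← coprod_z_mul] at h
    exact h

theorem mulEven_apply [NormedSpace ℂ W] [IsScalarTower ℝ ℂ W] (F : SmoothFn V ℂ)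
    (G : SmoothFn V W) (u : Env V) : (mulEven F G).toFun u = pairMap F G (coprod u) := rfl

/-- The invariant (Berezin) integral `∫_HC F = ∫_ℝ F(γ; x) dx`. -/
def superIntegral {n : ℕ} (b : OrthonormalBasis (Fin n) ℝ V) (F : SmoothFn V W) : W :=
  ∫ x : ℝ, F.toFun (gammaElt b) x

variable (V) in
/-- The complex valued smooth functions on the supergroup with support in `[-a, a]`. -/
def supportedIn (a : ℝ) : Set (SmoothFn V ℂ) :=
  {F | ∀ u : Env V, tsupport (F.toFun u) ⊆ Set.Icc (-a) a}

end Smooth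

/-! ## Spin modules -/

section Spin

/-- `[n]` is `n / 2` for even `n` and `(n + 1) / 2` for odd `n`. -/
def half (n : ℕ) : ℕ := (n + 1) / 2

/-- The index set of the standard basis of the spin module `𝒮`, a tensor product of `[n]` copies
of `ℂ²`.  If `n = 2k`, then `𝒮 = (ℂ^{1|1})^{⊗ k}`.  If `n = 2k + 1`, then `𝒮 = D ⊗ (ℂ²)^{⊗ k}`; the
tensor factor number `0` is `D = ℂ[ε]`, with basis `1, ε`. -/
abbrev SpinIdx (n : ℕ) := Fin (half n) → Fin 2

/-- The matrices of endomorphisms of `𝒮`. -/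
abbrev SpinMat (n : ℕ) := Matrix (SpinIdx n) (SpinIdx n) ℂ

/-- The matrix of `M₀ ⊗ M₁ ⊗ ⋯`. -/
def pureTensor {m : ℕ} (M : Fin m → Matrix (Fin 2) (Fin 2) ℂ) :
    Matrix (Fin m → Fin 2) (Fin m → Fin 2) ℂ :=
  Matrix.of fun s t => ∏ l, M l (s l) (t l)

/-- The grading operator of `ℂ^{1|1}`. -/
def gradMat : Matrix (Fin 2) (Fin 2) ℂ := !![1, 0; 0, -1]

/-- `c_ζ(a₁)` for `n = 2`; also the matrix of multiplication by `ε` on `D = ℂ[ε]`, `ε² = ζ`. -/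
def matX (ζ : ℂ) : Matrix (Fin 2) (Fin 2) ℂ := !![0, ζ; 1, 0]

/-- `c_ζ(a₂)` for `n = 2`. -/
def matY (ζ : ℂ) : Matrix (Fin 2) (Fin 2) ℂ := !![0, Complex.I * ζ; -Complex.I, 0]

/-- The super tensor product `1 ⊗ ⋯ ⊗ M ⊗ ⋯ ⊗ 1` with the odd operator `M` in the slot `p`: the sign
rule puts the grading operator into the slots `s, …, p - 1` (the slots before `s` are not graded). -/
def oddAt (m s p : ℕ) (M : Matrix (Fin 2) (Fin 2) ℂ) :
    Matrix (Fin m → Fin 2) (Fin m → Fin 2) ℂ :=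
  pureTensor fun l => if l.val = p then M else if s ≤ l.val ∧ l.val < p then gradMat else 1

/-- For odd `n`: multiplication by `ε` on `𝒮 = D ⊗ (ℂ²)^{⊗ k}`, where `ε² = ζ`. -/
def epsMat (n : ℕ) (ζ : ℂ) : SpinMat n :=
  pureTensor fun l => if l.val = 0 then matX ζ else 1

/-- For odd `n = 2k + 1`: the operator `1 ⊗ i^k c₁(a₁) ⋯ c₁(a_{2k})` on `D ⊗ (ℂ²)^{⊗ k}`, which is
the grading operator of `(ℂ^{1|1})^{⊗ k}`. -/
def chirMat (n : ℕ) : SpinMat n :=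
  pureTensor fun l => if l.val = 0 then 1 else gradMat

/-- The operators `c_ζ(aᵢ)`.

If `n = 2k` (basis `a_0, …, a_{2k-1}`), they are the images of the generators under
`Cl(ℂ²)^{⊗ k} = End(ℂ^{1|1})^{⊗ k} = End(𝒮)`.

If `n = 2k + 1` (basis `a_0, …, a_{2k}`), put `x_0 = ε ⊗ 1` and `x_j = 1 ⊗ c₁(a_{j-1})`, where `c₁` is
the representation for the even dimension `2k` and the parameter `1`; then
`c_ζ(a_0) = i^k x_0 x_1 ⋯ x_{2k}` and `c_ζ(a_j) = -i c_ζ(a_0) x_j` for `j ≥ 1`. -/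
def cGen (n : ℕ) (ζ : ℂ) (i : Fin n) : SpinMat n :=
  if Even n then
    oddAt (half n) 0 (i.val / 2) (if Even i.val then matX ζ else matY ζ)
  else if i.val = 0 then
    epsMat n ζ * chirMat n
  else
    (-Complex.I) • (epsMat n ζ * chirMat n *
      oddAt (half n) 1 ((i.val + 1) / 2) (if Even i.val then matY 1 else matX 1))

/-- The algebra `ℋ`: all endomorphisms of `𝒮` for even `n`, and the `D`-linear ones for odd `n`. -/
def spinEnd (n : ℕ) (ζ : ℂ) : Subalgebra ℂ (SpinMat n) :=
  if Even n then ⊤ else Subalgebra.centralizer ℂ {epsMat n ζ}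

/-- The functional `T`: the supertrace for even `n`, and `A ↦ Tr(e^{iπ/4} ε A)` for odd `n`. -/
def spinT (n : ℕ) (ζ : ℂ) (A : SpinMat n) : ℂ :=
  if Even n then ∑ s, (-1) ^ (∑ l, (s l).val) * A s s
  else Matrix.trace (Complex.exp (Complex.I * Real.pi / 4) • (epsMat n ζ * A))

theorem pureTensor_mul {m : ℕ} (M N : Fin m → Matrix (Fin 2) (Fin 2) ℂ) :
    pureTensor M * pureTensor N = pureTensor fun l => M l * N l := by
  ext s t
  simp only [Matrix.mul_apply, pureTensor, Matrix.of_apply, Finset.prod_univ_sum,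
    ← Finset.prod_mul_distrib, Fintype.piFinset_univ]

theorem pureTensor_one (m : ℕ) :
    pureTensor (fun _ : Fin m => (1 : Matrix (Fin 2) (Fin 2) ℂ)) = 1 := by
  ext s t
  simp only [pureTensor, Matrix.of_apply, Matrix.one_apply, Finset.prod_ite_zero,
    Finset.prod_const_one, Finset.mem_univ, forall_const, funext_iff]

theorem pureTensor_smul {m : ℕ} (e : Fin m → ℂ) (M : Fin m → Matrix (Fin 2) (Fin 2) ℂ) :
    pureTensor (fun l => e l • M l) = (∏ l, e l) • pureTensor M := by
  ext s t
  simp [pureTensor, Finset.prod_mul_distrib]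

theorem pureTensor_smul_one {m : ℕ} (p : Fin m) (c : ℂ)
    (M : Fin m → Matrix (Fin 2) (Fin 2) ℂ) (hp : M p = c • 1) (h : ∀ l, l ≠ p → M l = 1) :
    pureTensor M = c • 1 := by
  have : M = fun l => (if l = p then c else 1) • (1 : Matrix (Fin 2) (Fin 2) ℂ) := by
    funext l
    by_cases hl : l = p
    · simp [hl, hp]
    · simp [hl, h l hl]
  rw [this, pureTensor_smul, pureTensor_one]
  simp

theorem pureTensor_anticomm {m : ℕ} (p : Fin m) (M N : Fin m → Matrix (Fin 2) (Fin 2) ℂ)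
    (hp : M p * N p = -(N p * M p)) (h : ∀ l, l ≠ p → M l * N l = N l * M l) :
    pureTensor M * pureTensor N = -(pureTensor N * pureTensor M) := by
  rw [pureTensor_mul, pureTensor_mul]
  have : (fun l => M l * N l) = fun l => (if l = p then (-1 : ℂ) else 1) • (N l * M l) := by
    funext l
    by_cases hl : l = p
    · subst hl
      simp [hp]
    · simp [hl, h l hl]
  rw [this, pureTensor_smul]
  simp

theorem pureTensor_comm {m : ℕ} (M N : Fin m → Matrix (Fin 2) (Fin 2) ℂ)
    (h : ∀ l, M l * N l = N l * M l) :
    pureTensor M * pureTensor N = pureTensor N * pureTensor M := by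
  rw [pureTensor_mul, pureTensor_mul]
  simp only [h]

theorem gradMat_sq : gradMat * gradMat = 1 := by
  ext i j; fin_cases i <;> fin_cases j <;> simp [gradMat]

theorem matX_sq (ζ : ℂ) : matX ζ * matX ζ = ζ • 1 := by
  ext i j; fin_cases i <;> fin_cases j <;> simp [matX]

theorem matY_sq (ζ : ℂ) : matY ζ * matY ζ = ζ • 1 := by
  have h : Complex.I * (Complex.I * ζ) = -ζ := by
    rw [← mul_assoc, Complex.I_mul_I, neg_one_mul]
  ext i j; fin_cases i <;> fin_cases j <;> simp [matY, mul_right_comm _ ζ, h]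

theorem matX_matY (ζ : ℂ) : matX ζ * matY ζ = -(matY ζ * matX ζ) := by
  ext i j; fin_cases i <;> fin_cases j <;> simp [matX, matY, mul_comm]

theorem matX_grad (ζ : ℂ) : matX ζ * gradMat = -(gradMat * matX ζ) := by
  ext i j; fin_cases i <;> fin_cases j <;> simp [matX, gradMat]

theorem matY_grad (ζ : ℂ) : matY ζ * gradMat = -(gradMat * matY ζ) := by
  ext i j; fin_cases i <;> fin_cases j <;> simp [matY, gradMat]

theorem oddAt_sq {m s p : ℕ} (hp : p < m) {M : Matrix (Fin 2) (Fin 2) ℂ} {c : ℂ}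
    (hM : M * M = c • 1) : oddAt m s p M * oddAt m s p M = c • 1 := by
  rw [oddAt, pureTensor_mul]
  refine pureTensor_smul_one ⟨p, hp⟩ c _ (by simpa using hM) ?_
  intro l hl
  have hl' : l.val ≠ p := fun h => hl (Fin.ext h)
  by_cases h : s ≤ l.val ∧ l.val < p <;> simp [hl', h, gradMat_sq]

theorem oddAt_anticomm_same {m s p : ℕ} (hp : p < m) {M N : Matrix (Fin 2) (Fin 2) ℂ}
    (h : M * N = -(N * M)) : oddAt m s p M * oddAt m s p N = -(oddAt m s p N * oddAt m s p M) := by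
  refine pureTensor_anticomm ⟨p, hp⟩ _ _ (by simpa using h) ?_
  intro l hl
  have hl' : l.val ≠ p := fun h => hl (Fin.ext h)
  simp [hl']

theorem oddAt_anticomm_lt {m s p q : ℕ} (hs : s ≤ p) (hpq : p < q) (hq : q < m)
    {M N : Matrix (Fin 2) (Fin 2) ℂ} (hM : M * gradMat = -(gradMat * M)) :
    oddAt m s p M * oddAt m s q N = -(oddAt m s q N * oddAt m s p M) := by
  refine pureTensor_anticomm ⟨p, hpq.trans hq⟩ _ _ (by simpa [hs, hpq, hpq.ne] using hM) ?_
  intro l hl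
  have hl' : l.val ≠ p := fun h => hl (Fin.ext h)
  by_cases h1 : l.val = q
  · have : ¬ (l.val < p) := by omega
    simp [hl', this]
  · by_cases h2 : s ≤ l.val ∧ l.val < q <;> by_cases h3 : s ≤ l.val ∧ l.val < p <;>
      simp [hl', h1, h2, h3]

theorem oddAt_anticomm_ne {m s p q : ℕ} (hsp : s ≤ p) (hsq : s ≤ q) (hpq : p ≠ q)
    (hp : p < m) (hq : q < m) {M N : Matrix (Fin 2) (Fin 2) ℂ}
    (hM : M * gradMat = -(gradMat * M)) (hN : N * gradMat = -(gradMat * N)) :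
    oddAt m s p M * oddAt m s q N = -(oddAt m s q N * oddAt m s p M) := by
  rcases lt_or_gt_of_ne hpq with h | h
  · exact oddAt_anticomm_lt hsp h hq hM
  · rw [oddAt_anticomm_lt hsq h hp hN, neg_neg]

theorem epsMat_sq {n : ℕ} (hn : ¬ Even n) (ζ : ℂ) : epsMat n ζ * epsMat n ζ = ζ • 1 := by
  have h0 : 0 < half n := by
    rcases n with _ | n
    · simp at hn
    · unfold half; omega
  rw [epsMat, pureTensor_mul]
  refine pureTensor_smul_one ⟨0, h0⟩ ζ _ (by simpa using matX_sq ζ) ?_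
  intro l hl
  have hl' : l.val ≠ 0 := fun h => hl (Fin.ext h)
  simp [hl']

theorem chirMat_sq (n : ℕ) : chirMat n * chirMat n = 1 := by
  rw [chirMat, pureTensor_mul, ← pureTensor_one]
  congr 1
  funext l
  by_cases h : l.val = 0 <;> simp [h, gradMat_sq]

theorem epsMat_chirMat (n : ℕ) (ζ : ℂ) : epsMat n ζ * chirMat n = chirMat n * epsMat n ζ := by
  refine pureTensor_comm _ _ fun l => ?_
  by_cases h : l.val = 0 <;> simp [h]

theorem epsMat_oddAt {n p : ℕ} (hp : 1 ≤ p) (ζ : ℂ) (M : Matrix (Fin 2) (Fin 2) ℂ) :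
    epsMat n ζ * oddAt (half n) 1 p M = oddAt (half n) 1 p M * epsMat n ζ := by
  refine pureTensor_comm _ _ fun l => ?_
  by_cases h : l.val = 0
  · have : ¬ (0 = p) := by omega
    simp [h, this]
  · simp [h]

theorem chirMat_oddAt {n p : ℕ} (hp : 1 ≤ p) (hp' : p < half n) {M : Matrix (Fin 2) (Fin 2) ℂ}
    (hM : M * gradMat = -(gradMat * M)) :
    oddAt (half n) 1 p M * chirMat n = -(chirMat n * oddAt (half n) 1 p M) := by
  have hp0 : p ≠ 0 := by omega
  refine pureTensor_anticomm ⟨p, hp'⟩ _ _ (by simpa [hp0] using hM) ?_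
  intro l hl
  have hl' : l.val ≠ p := fun h => hl (Fin.ext h)
  by_cases h : l.val = 0
  · simp [h]
  · by_cases h2 : 1 ≤ l.val ∧ l.val < p <;> simp [hl', h, h2]

theorem odd_gen_mul {A : Type*} [Ring A] [Algebra ℂ A] {E G x y : A} {ζ : ℂ}
    (hE : E * E = ζ • 1) (hG : G * G = 1) (hEG : E * G = G * E) (hEx : E * x = x * E)
    (hGx : x * G = -(G * x)) :
    ((-Complex.I) • (E * G * x)) * ((-Complex.I) • (E * G * y)) = ζ • (x * y) := by
  have h : E * G * x * (E * G * y) = -(ζ • (x * y)) := by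
    calc E * G * x * (E * G * y) = E * G * (x * E) * (G * y) := by simp only [mul_assoc]
      _ = E * (G * E) * (x * G) * y := by rw [← hEx]; simp only [mul_assoc]
      _ = -((E * E) * (G * G) * (x * y)) := by
          rw [← hEG, hGx]; simp only [mul_assoc, mul_neg, neg_mul]
      _ = -(ζ • (x * y)) := by rw [hE, hG]; simp
  rw [smul_mul_smul_comm, h, neg_mul_neg, Complex.I_mul_I]
  simp

theorem odd_gen_zero {A : Type*} [Ring A] [Algebra ℂ A] {E G x : A}
    (hEx : E * x = x * E) (hGx : x * G = -(G * x)) :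
    (E * G) * ((-Complex.I) • (E * G * x)) = -(((-Complex.I) • (E * G * x)) * (E * G)) := by
  have h : E * G * (E * G * x) = -(E * G * x * (E * G)) := by
    calc E * G * (E * G * x) = -(E * G * E * (x * G)) := by
          rw [hGx]; simp only [mul_assoc, mul_neg, neg_neg]
      _ = -(E * G * x * (E * G)) := by
          rw [mul_assoc (E * G) E, ← mul_assoc E x, hEx]; simp only [mul_assoc]
  rw [mul_smul_comm, smul_mul_assoc, h, smul_neg]

theorem cGen_sq {n : ℕ} (ζ : ℂ) (i : Fin n) : cGen n ζ i * cGen n ζ i = ζ • 1 := by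
  have hi := i.isLt
  by_cases hn : Even n
  · have hp : i.val / 2 < half n := by
      obtain ⟨k, hk⟩ := hn
      unfold half; omega
    simp only [cGen, hn, if_true]
    split_ifs
    · exact oddAt_sq hp (matX_sq ζ)
    · exact oddAt_sq hp (matY_sq ζ)
  · have hEG := epsMat_chirMat n ζ
    have hE := epsMat_sq hn ζ
    have hG := chirMat_sq n
    by_cases h0 : i.val = 0
    · simp only [cGen, hn, if_false, h0, if_true]
      rw [mul_assoc, ← mul_assoc (chirMat n), ← hEG, mul_assoc (epsMat n ζ), hG, mul_one, hE]
    have hp : (i.val + 1) / 2 < half n := by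
      rw [Nat.not_even_iff_odd] at hn
      obtain ⟨k, hk⟩ := hn
      unfold half; omega
    have hp1 : 1 ≤ (i.val + 1) / 2 := by omega
    simp only [cGen, hn, h0, if_false]
    split_ifs
    · rw [odd_gen_mul hE hG hEG (epsMat_oddAt hp1 ζ _) (chirMat_oddAt hp1 hp (matY_grad 1)),
        oddAt_sq hp (matY_sq 1), one_smul]
    · rw [odd_gen_mul hE hG hEG (epsMat_oddAt hp1 ζ _) (chirMat_oddAt hp1 hp (matX_grad 1)),
        oddAt_sq hp (matX_sq 1), one_smul]

theorem matXY_grad (P : Prop) [Decidable P] (ζ : ℂ) :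
    (if P then matX ζ else matY ζ) * gradMat = -(gradMat * if P then matX ζ else matY ζ) := by
  split_ifs
  · exact matX_grad ζ
  · exact matY_grad ζ

theorem cGen_anticomm_of_odd_of_pos {n : ℕ} (hn : ¬ Even n) (ζ : ℂ) {i j : Fin n} (hij : i ≠ j)
    (hi0 : i.val ≠ 0) (hj0 : j.val ≠ 0) :
    cGen n ζ i * cGen n ζ j = -(cGen n ζ j * cGen n ζ i) := by
  have hi := i.isLt
  have hj := j.isLt
  have hij' : i.val ≠ j.val := fun h => hij (Fin.ext h)
  have hEG := epsMat_chirMat n ζ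
  have hE := epsMat_sq hn ζ
  have hG := chirMat_sq n
  obtain ⟨k, hk⟩ := Nat.not_even_iff_odd.1 hn
  have hpi : (i.val + 1) / 2 < half n := by unfold half; omega
  have hpj : (j.val + 1) / 2 < half n := by unfold half; omega
  have hpi1 : 1 ≤ (i.val + 1) / 2 := by omega
  have hpj1 : 1 ≤ (j.val + 1) / 2 := by omega
  simp only [cGen, hn, hi0, hj0, if_false, ← ite_not (Even _) (matX 1) (matY 1)]
  rw [odd_gen_mul hE hG hEG (epsMat_oddAt hpi1 ζ _) (chirMat_oddAt hpi1 hpi (matXY_grad _ 1)),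
    odd_gen_mul hE hG hEG (epsMat_oddAt hpj1 ζ _) (chirMat_oddAt hpj1 hpj (matXY_grad _ 1)),
    ← smul_neg]
  congr 1
  by_cases hpq : (i.val + 1) / 2 = (j.val + 1) / 2
  · rw [hpq]
    by_cases hie : Even i.val
    · have hje : ¬ Even j.val := by
        rw [Nat.even_iff] at hie ⊢; omega
      simp only [hie, hje, not_true, not_false_eq_true, if_true, if_false]
      refine oddAt_anticomm_same hpj ?_
      rw [matX_matY, neg_neg]
    · have hje : Even j.val := by
        rw [Nat.even_iff] at hie ⊢; omega
      simp only [hie, hje, not_true, not_false_eq_true, if_true, if_false]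
      exact oddAt_anticomm_same hpj (matX_matY 1)
  · exact oddAt_anticomm_ne hpi1 hpj1 hpq hpi hpj (matXY_grad _ 1) (matXY_grad _ 1)

theorem cGen_anticomm {n : ℕ} (ζ : ℂ) {i j : Fin n} (hij : i ≠ j) :
    cGen n ζ i * cGen n ζ j = -(cGen n ζ j * cGen n ζ i) := by
  have hi := i.isLt
  have hj := j.isLt
  have hij' : i.val ≠ j.val := fun h => hij (Fin.ext h)
  by_cases hn : Even n
  · obtain ⟨k, hk⟩ := id hn
    have hpi : i.val / 2 < half n := by unfold half; omega
    have hpj : j.val / 2 < half n := by unfold half; omega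
    simp only [cGen, hn, if_true]
    by_cases hpq : i.val / 2 = j.val / 2
    · rw [hpq]
      by_cases hie : Even i.val
      · have hje : ¬ Even j.val := by
          rw [Nat.even_iff] at hie ⊢; omega
        simp only [hie, hje, if_true, if_false]
        exact oddAt_anticomm_same hpj (matX_matY ζ)
      · have hje : Even j.val := by
          rw [Nat.even_iff] at hie ⊢; omega
        simp only [hie, hje, if_true, if_false]
        refine oddAt_anticomm_same hpj ?_
        rw [matX_matY, neg_neg]
    · exact oddAt_anticomm_ne (Nat.zero_le _) (Nat.zero_le _) hpq hpi hpj (matXY_grad _ ζ)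
        (matXY_grad _ ζ)
  · have key : ∀ {i j : Fin n}, i.val = 0 → j.val ≠ 0 →
        cGen n ζ i * cGen n ζ j = -(cGen n ζ j * cGen n ζ i) := by
      intro i j hi0 hj0
      have hj := j.isLt
      obtain ⟨k, hk⟩ := Nat.not_even_iff_odd.1 hn
      have hpj : (j.val + 1) / 2 < half n := by unfold half; omega
      have hpj1 : 1 ≤ (j.val + 1) / 2 := by omega
      simp only [cGen, hn, hi0, hj0, if_false, if_true, ← ite_not (Even _) (matX 1) (matY 1)]
      exact odd_gen_zero (epsMat_oddAt hpj1 ζ _)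
        (chirMat_oddAt hpj1 hpj (matXY_grad _ 1))
    by_cases hi0 : i.val = 0
    · exact key hi0 (by omega)
    · by_cases hj0 : j.val = 0
      · rw [key hj0 hi0, neg_neg]
      · exact cGen_anticomm_of_odd_of_pos hn ζ hij hi0 hj0

theorem cGen_clifford {n : ℕ} (ζ : ℂ) (i j : Fin n) :
    cGen n ζ i * cGen n ζ j + cGen n ζ j * cGen n ζ i = (if i = j then 2 * ζ else 0) • 1 := by
  by_cases h : i = j
  · subst h
    rw [cGen_sq, if_pos rfl, ← add_smul, two_mul]
  · rw [cGen_anticomm ζ h, if_neg h, zero_smul, neg_add_cancel]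

variable {V : Type*} [NormedAddCommGroup V] [InnerProductSpace ℝ V] {n : ℕ}

/-- The Clifford multiplication `c_ζ(v)` for `v ∈ V`. -/
def cliff (b : OrthonormalBasis (Fin n) ℝ V) (ζ : ℂ) : V →ₗ[ℝ] SpinMat n where
  toFun v := ∑ i, b.repr v i • cGen n ζ i
  map_add' v w := by simp [add_smul, Finset.sum_add_distrib]
  map_smul' c v := by simp [mul_smul, Finset.smul_sum]

theorem cliff_mul_add (b : OrthonormalBasis (Fin n) ℝ V) (ζ : ℂ) (v w : V) :
    cliff b ζ v * cliff b ζ w + cliff b ζ w * cliff b ζ v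
      = ((2 * inner ℝ v w : ℝ) * ζ : ℂ) • 1 := by
  have h1 : cliff b ζ w * cliff b ζ v
      = ∑ i, ∑ j, (b.repr v i * b.repr w j) • (cGen n ζ j * cGen n ζ i) := by
    change (∑ j, b.repr w j • cGen n ζ j) * (∑ i, b.repr v i • cGen n ζ i) = _
    rw [Finset.sum_mul_sum, Finset.sum_comm]
    simp only [smul_mul_smul_comm, mul_comm]
  have h2 : cliff b ζ v * cliff b ζ w
      = ∑ i, ∑ j, (b.repr v i * b.repr w j) • (cGen n ζ i * cGen n ζ j) := by
    change (∑ j, b.repr v j • cGen n ζ j) * (∑ i, b.repr w i • cGen n ζ i) = _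
    rw [Finset.sum_mul_sum]
    simp only [smul_mul_smul_comm]
  have h3 : inner ℝ v w = ∑ i, b.repr v i * b.repr w i := by
    rw [← b.repr.inner_map_map v w, PiLp.inner_apply]
    simp [mul_comm]
  rw [h1, h2, ← Finset.sum_add_distrib]
  simp only [← Finset.sum_add_distrib, ← smul_add, cGen_clifford]
  simp only [ite_smul, zero_smul, smul_ite, smul_zero, Finset.sum_ite_eq, Finset.mem_univ, if_true]
  rw [h3, Finset.mul_sum, Complex.ofReal_sum, Finset.sum_mul, Finset.sum_smul]
  refine Finset.sum_congr rfl fun i _ => ?_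
  rw [← Complex.coe_smul, smul_smul]
  congr 1
  push_cast
  ring

/-- The restriction of `dπ_ζ` to `hc`: `dπ_ζ(v) = e^{iπ/4} c_ζ(v)` for `v ∈ V`, and
`dπ_ζ(z) = iζ`. -/
def spinRepLin (b : OrthonormalBasis (Fin n) ℝ V) (ζ : ℂ) : HC V →ₗ[ℝ] SpinMat n where
  toFun x := Complex.exp (Complex.I * Real.pi / 4) • cliff b ζ x.1
    + (Complex.I * ζ * x.2) • (1 : SpinMat n)
  map_add' x y := by
    simp only [Prod.fst_add, Prod.snd_add, map_add, smul_add, Complex.ofReal_add, mul_add, add_smul]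
    abel
  map_smul' c x := by
    simp only [Prod.smul_fst, Prod.smul_snd, map_smul, smul_add, RingHom.id_apply, smul_eq_mul,
      Complex.ofReal_mul]
    congr 1
    · rw [smul_comm]
    · rw [← Complex.coe_smul, smul_smul]
      congr 1
      ring

theorem exp_quarter_sq :
    Complex.exp (Complex.I * Real.pi / 4) * Complex.exp (Complex.I * Real.pi / 4) = Complex.I := by
  rw [← Complex.exp_add]
  convert Complex.exp_pi_div_two_mul_I using 2
  ring

/-- The representation `dπ_ζ` of `U(hc)` on the spin module `𝒮`. -/
def spinRep (b : OrthonormalBasis (Fin n) ℝ V) (ζ : ℂ) : Env V →ₐ[ℝ] SpinMat n :=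
  lift (spinRepLin b ζ)
    (by
      intro v w
      have h := cliff_mul_add b ζ v w
      simp only [spinRepLin, LinearMap.coe_mk, AddHom.coe_mk, Complex.ofReal_zero, mul_zero,
        zero_smul, add_zero, map_zero, smul_zero, zero_add, smul_mul_smul_comm, exp_quarter_sq]
      rw [← smul_add, h, smul_smul]
      congr 1
      ring)
    (by
      intro t x
      simp only [spinRepLin, LinearMap.coe_mk, AddHom.coe_mk, map_zero, smul_zero, zero_add,
        smul_mul_assoc, one_mul, mul_smul_comm, mul_one])

theorem spinRep_z (b : OrthonormalBasis (Fin n) ℝ V) (ζ : ℂ) :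
    spinRep b ζ zElt = (Complex.I * ζ) • 1 := by
  rw [spinRep, zElt, lift_ι]
  simp [spinRepLin]

end Spin

/-! ## The Fourier--Laplace transform -/

section Fourier

attribute [local instance] Matrix.normedAddCommGroup Matrix.normedSpace

variable {V : Type*} [NormedAddCommGroup V] [InnerProductSpace ℝ V] {n : ℕ}

/-- The representation `π_ζ` as an (even) smooth function on the supergroup with values in the
endomorphisms of `𝒮`: `π_ζ(u; x) = e^{iζx} dπ_ζ(u)`. -/
def spinFn (b : OrthonormalBasis (Fin n) ℝ V) (ζ : ℂ) : SmoothFn V (SpinMat n) where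
  toFun :=
    { toFun := fun u x => Complex.exp (Complex.I * ζ * x) • spinRep b ζ u
      map_add' := by intro u v; funext x; simp
      map_smul' := by
        intro c u; funext x
        simp only [map_smul, RingHom.id_apply, Pi.smul_apply]
        rw [smul_comm] }
  smooth u := by
    have h : ContDiff ℝ ∞ fun x : ℝ => Complex.exp (Complex.I * ζ * x) :=
      (contDiff_const.mul Complex.ofRealCLM.contDiff).cexp
    exact h.smul contDiff_const
  z_mul u := by
    funext x
    have h1 : HasDerivAt (fun x : ℝ => Complex.I * ζ * (x : ℂ)) (Complex.I * ζ * 1) x :=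
      (Complex.ofRealCLM.hasDerivAt (x := x)).const_mul (Complex.I * ζ)
    have h2 := (h1.cexp.smul_const (spinRep b ζ u)).deriv
    refine Eq.trans ?_ h2.symm
    simp only [LinearMap.coe_mk, AddHom.coe_mk, map_mul, spinRep_z, smul_mul_assoc, one_mul,
      smul_smul, mul_one]

/-- The Fourier--Laplace transform `ζ ↦ ∫_HC F · π_{-ζ}`. -/
def fourierLaplace (b : OrthonormalBasis (Fin n) ℝ V) (F : SmoothFn V ℂ) : ℂ → SpinMat n :=
  fun ζ => superIntegral b (mulEven F (spinFn b (-ζ)))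

/-- The entire functions `A : ℂ → ℋ` of exponential type `a`.  In odd dimension the algebra `ℋ`
depends on the parameter of the representation; `A(ζ)` and `dπ_{-ζ}(u)` lie in the algebra with
parameter `-ζ`. -/
def exponentialType (b : OrthonormalBasis (Fin n) ℝ V) (a : ℝ) : Set (ℂ → SpinMat n) :=
  {A | (∀ ζ, A ζ ∈ spinEnd n (-ζ)) ∧ Differentiable ℂ A ∧
    ∀ (u : Env V) (N : ℕ), ∃ C : ℝ, ∀ ζ : ℂ, ζ ≠ 0 →
      ‖(ζ ^ half n)⁻¹ * spinT n (-ζ) (A ζ * spinRep b (-ζ) u)‖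
        ≤ C * ((1 + ‖ζ‖) ^ N)⁻¹ * Real.exp (a * |ζ.im|)}

end Fourier

end HeisenbergClifford

end

/-! The theorem reduces to the classical Paley–Wiener theorem, applied to `2^n` scalar functions.
Ordered monomials `z^k a_K`, for `K` a subset of the indices, form a basis of the enveloping
algebra. As `z` acts by differentiation, a smooth function `F` is the same thing as a free choice of
the components `f_K = F(a_K)`, and `F` is supported in `[-a, a]` exactly when every `f_K` is
(`exists_smoothFn`, `SmoothFn.ext_mon`, `mem_supportedIn_iff`).

The coproduct of `γ` is `∑ ± a_I ⊗ a_{Iᶜ}`. Hence the transform at `ζ` is the sum over `I` of `±`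
the scalar transform of `f_I` times `dπ_{-ζ}(a_{Iᶜ})` (`exists_fourierLaplace_eq`). The functional
`T` separates these terms: for `ζ ≠ 0`, `T(dπ_ζ(a_I) dπ_ζ(a_K))` is zero unless `I = Kᶜ`, and then
it is a nonzero constant times `ζ^[n]` (`exists_spinTLin_pairing`). So `ζ^{-[n]} T(F̂(ζ)
dπ_{-ζ}(a_K))` is a nonzero multiple of the scalar transform of `f_K`, and the exponential type
condition becomes the Paley–Wiener bound for each component.

Conversely, the functions `ζ^{-[n]} T(A(ζ) dπ_{-ζ}(a_K))` of a given `A` are bounded near the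
origin, so they extend to entire functions. Their inverse transforms are the components of some `F`.
Then `F̂` and `A` have equal pairings with all monomials. For `ζ ≠ 0` these `2^n` independent
monomials span `ℋ` by a dimension count, so `F̂ = A` there (`eq_zero_of_spinTLin_eq_zero`), and at
the origin by continuity.

The same pairing yields the independence part of Poincaré–Birkhoff–Witt, since the spin
representations with varying `ζ` jointly separate the monomials (`linearIndependent_env`). -/

noncomputable section

namespace HeisenbergClifford

/-! ## The classical Paley--Wiener theorem on the line -/

section PaleyWiener

open MeasureTheory Filter Topology Complex

/-- The Fourier--Laplace transform of a function on the line. -/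
def laplace (f : ℝ → ℂ) (ζ : ℂ) : ℂ := ∫ x : ℝ, f x * cexp (I * -ζ * x)

/-- Rapid decay on horizontal lines, and exponential growth of type `a` in vertical directions. -/
def PaleyWienerBound (a : ℝ) (g : ℂ → ℂ) : Prop :=
  ∀ N : ℕ, ∃ C : ℝ, ∀ ζ : ℂ, ‖g ζ‖ * (1 + ‖ζ‖) ^ N ≤ C * Real.exp (a * |ζ.im|)

theorem norm_cexp_neg_mul (ζ : ℂ) (x : ℝ) : ‖cexp (I * -ζ * x)‖ = Real.exp (ζ.im * x) := by
  rw [norm_exp]; congr 1; simp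

/-! ### Transforms of smooth functions with compact support -/

section Forward

variable {a : ℝ} {f : ℝ → ℂ}

theorem hasCompactSupport_of_tsupport_subset (hs : tsupport f ⊆ Set.Icc (-a) a) :
    HasCompactSupport f :=
  isCompact_Icc.of_isClosed_subset (isClosed_tsupport f) hs

theorem integrable_mul_of_tsupport_subset (hf : Continuous f) (hs : tsupport f ⊆ Set.Icc (-a) a)
    {h : ℝ → ℂ} (hh : Continuous h) : Integrable fun x => f x * h x :=
  (hf.mul hh).integrable_of_hasCompactSupport
    ((hasCompactSupport_of_tsupport_subset hs).mul_right)

theorem integrable_laplace (hf : Continuous f) (hs : tsupport f ⊆ Set.Icc (-a) a) (ζ : ℂ) :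
    Integrable fun x : ℝ => f x * cexp (I * -ζ * x) :=
  integrable_mul_of_tsupport_subset hf hs (by fun_prop)

/-- On the support `|x| ≤ a`, so the kernel has absolute value at most `e^{a|Im ζ|}`; elsewhere the
integrand vanishes. -/
theorem norm_laplace_le (hf : Continuous f) (hs : tsupport f ⊆ Set.Icc (-a) a) (ζ : ℂ) :
    ‖laplace f ζ‖ ≤ (∫ x, ‖f x‖) * Real.exp (a * |ζ.im|) := by
  rw [← integral_mul_const]
  refine norm_integral_le_of_norm_le
    ((hf.integrable_of_hasCompactSupport (hasCompactSupport_of_tsupport_subset hs)).norm.mul_const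
      _) (Eventually.of_forall fun x => ?_)
  rw [norm_mul, norm_cexp_neg_mul]
  by_cases hx : x ∈ tsupport f
  · refine mul_le_mul_of_nonneg_left (Real.exp_le_exp.2 ?_) (norm_nonneg _)
    have h1 : |x| ≤ a := abs_le.2 (hs hx)
    calc ζ.im * x ≤ |ζ.im * x| := le_abs_self _
      _ = |x| * |ζ.im| := by rw [abs_mul, mul_comm]
      _ ≤ a * |ζ.im| := by gcongr
  · rw [image_eq_zero_of_notMem_tsupport hx]; simp

/-- Integration by parts: `f x * e^{-iζx}` is compactly supported, so its derivative has integral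
zero. -/
theorem laplace_deriv (hf : ContDiff ℝ ∞ f) (hs : tsupport f ⊆ Set.Icc (-a) a) (ζ : ℂ) :
    laplace (deriv f) ζ = I * ζ * laplace f ζ := by
  have hc : Continuous (deriv f) := hf.continuous_deriv (by simp)
  have hs' : tsupport (deriv f) ⊆ Set.Icc (-a) a := (tsupport_deriv_subset).trans hs
  have hd : ∀ x : ℝ, HasDerivAt (fun x : ℝ => f x * cexp (I * -ζ * x))
      (deriv f x * cexp (I * -ζ * x) - I * ζ * (f x * cexp (I * -ζ * x))) x := by
    intro x
    have h1 : HasDerivAt (fun x : ℝ => I * -ζ * (x : ℂ)) (I * -ζ * 1) x :=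
      (Complex.ofRealCLM.hasDerivAt (x := x)).const_mul (I * -ζ)
    have h2 := (hf.differentiable (by simp) x).hasDerivAt.mul h1.cexp
    refine h2.congr_deriv ?_
    ring
  have h0 := integral_eq_zero_of_hasDerivAt_of_integrable hd
    ((integrable_laplace hc hs' ζ).sub ((integrable_laplace hf.continuous hs ζ).const_mul _))
    (integrable_laplace hf.continuous hs ζ)
  rw [integral_sub (integrable_laplace hc hs' ζ)
    ((integrable_laplace hf.continuous hs ζ).const_mul _), integral_const_mul, sub_eq_zero] at h0
  exact h0

theorem tsupport_iteratedDeriv_subset (hs : tsupport f ⊆ Set.Icc (-a) a) (k : ℕ) :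
    tsupport (deriv^[k] f) ⊆ Set.Icc (-a) a := by
  induction k with
  | zero => exact hs
  | succ k ih =>
    rw [Function.iterate_succ_apply']
    exact (tsupport_deriv_subset).trans ih

theorem laplace_iterate_deriv (hf : ContDiff ℝ ∞ f) (hs : tsupport f ⊆ Set.Icc (-a) a) (ζ : ℂ)
    (k : ℕ) : laplace (deriv^[k] f) ζ = (I * ζ) ^ k * laplace f ζ := by
  induction k with
  | zero => simp
  | succ k ih =>
    rw [Function.iterate_succ_apply', laplace_deriv (hf.iterate_deriv k)
      (tsupport_iteratedDeriv_subset hs k), ih]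
    ring

/-- The exponential bound for the `N`-th derivative of `f` controls `|ζ|^N` times the transform.
Convexity, `(1 + |ζ|)^N ≤ 2^(N-1) (1 + |ζ|^N)`, combines it with the bound for `f` itself. -/
theorem paleyWienerBound_laplace (hf : ContDiff ℝ ∞ f) (hs : tsupport f ⊆ Set.Icc (-a) a) :
    PaleyWienerBound a (laplace f) := by
  intro N
  refine ⟨2 ^ (N - 1) * ((∫ x, ‖f x‖) + ∫ x, ‖(deriv^[N] f) x‖), fun ζ => ?_⟩
  have h0 := norm_laplace_le hf.continuous hs ζ
  have h1 := norm_laplace_le (hf.iterate_deriv N).continuous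
    (tsupport_iteratedDeriv_subset hs N) ζ
  rw [laplace_iterate_deriv hf hs, norm_mul, norm_pow, norm_mul, norm_I, one_mul] at h1
  calc ‖laplace f ζ‖ * (1 + ‖ζ‖) ^ N
      ≤ ‖laplace f ζ‖ * (2 ^ (N - 1) * (1 ^ N + ‖ζ‖ ^ N)) := by
        gcongr
        exact add_pow_le zero_le_one (norm_nonneg _) N
    _ = 2 ^ (N - 1) * (‖laplace f ζ‖ + ‖ζ‖ ^ N * ‖laplace f ζ‖) := by ring
    _ ≤ 2 ^ (N - 1) * ((∫ x, ‖f x‖) * Real.exp (a * |ζ.im|)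
          + (∫ x, ‖(deriv^[N] f) x‖) * Real.exp (a * |ζ.im|)) := by gcongr
    _ = _ := by ring

/-- Differentiation under the integral sign: on the unit ball around `ζ` the derivative of the
integrand is dominated by a continuous function supported where `f` is. -/
theorem differentiable_laplace (hf : Continuous f) (hs : tsupport f ⊆ Set.Icc (-a) a) :
    Differentiable ℂ (laplace f) := by
  intro ζ
  have hcs := hasCompactSupport_of_tsupport_subset hs
  refine (hasDerivAt_integral_of_dominated_loc_of_deriv_le (Metric.ball_mem_nhds ζ one_pos)
    (F := fun (ζ : ℂ) (x : ℝ) => f x * cexp (I * -ζ * x))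
    (F' := fun (ζ : ℂ) (x : ℝ) => f x * (cexp (I * -ζ * x) * (I * -1 * x)))
    (bound := fun x : ℝ => ‖f x‖ * (Real.exp ((‖ζ‖ + 1) * |x|) * |x|))
    (Eventually.of_forall fun ζ => (integrable_laplace hf hs ζ).aestronglyMeasurable)
    (integrable_laplace hf hs ζ)
    (integrable_mul_of_tsupport_subset hf hs (by fun_prop)).aestronglyMeasurable
    (Eventually.of_forall fun x w hw => ?_) ?_
    (Eventually.of_forall fun x w _ => ?_)).2.differentiableAt
  · rw [norm_mul, norm_mul, norm_cexp_neg_mul]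
    have h2 : ‖I * -1 * (x : ℂ)‖ = |x| := by simp
    rw [h2]
    have h3 : ‖w‖ ≤ ‖ζ‖ + 1 := by
      have h4 : ‖w - ζ‖ < 1 := by simpa [dist_eq_norm] using hw
      have := norm_le_norm_add_norm_sub' w ζ
      linarith
    refine mul_le_mul_of_nonneg_left (mul_le_mul_of_nonneg_right (Real.exp_le_exp.2 ?_)
      (abs_nonneg x)) (norm_nonneg _)
    calc w.im * x ≤ |w.im| * |x| := (le_abs_self _).trans (abs_mul _ _).le
      _ ≤ (‖ζ‖ + 1) * |x| := by gcongr; exact (abs_im_le_norm w).trans h3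
  · exact (hf.norm.mul (by fun_prop)).integrable_of_hasCompactSupport hcs.norm.mul_right
  · have h1 : HasDerivAt (fun w : ℂ => I * -w * (x : ℂ)) (I * -1 * x) w :=
      (((hasDerivAt_id w).neg).const_mul I).mul_const _
    exact h1.cexp.const_mul _

end Forward

/-! ### Inverse transforms of entire functions: contour shift and Fourier inversion -/

open FourierTransform

theorem integrable_of_norm_le_inv_one_add_sq {h : ℝ → ℂ} (hc : Continuous h) {C : ℝ}
    (hb : ∀ x, ‖h x‖ ≤ C * (1 + x ^ 2)⁻¹) : Integrable h :=
  (integrable_inv_one_add_sq.const_mul C).mono' hc.aestronglyMeasurable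
    (Eventually.of_forall hb)

/-- Shifting the line of integration of an entire function with quadratic decay. -/
theorem integral_horizontal_shift {h : ℂ → ℂ} (hd : Differentiable ℂ h) {η C : ℝ}
    (hb : ∀ x y : ℝ, |y| ≤ |η| → ‖h (x + y * I)‖ ≤ C * (1 + x ^ 2)⁻¹) :
    ∫ x : ℝ, h (x + η * I) = ∫ x : ℝ, h x := by
  have hc := hd.continuous
  have i0 : Integrable fun x : ℝ => h x :=
    integrable_of_norm_le_inv_one_add_sq (by fun_prop) (C := C) fun x => by
      simpa using hb x 0 (by simp)
  have i1 : Integrable fun x : ℝ => h (x + η * I) :=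
    integrable_of_norm_le_inv_one_add_sq (by fun_prop) (C := C) fun x => hb x η le_rfl
  have t0 := intervalIntegral_tendsto_integral i0 tendsto_neg_atTop_atBot tendsto_id
  have t1 := intervalIntegral_tendsto_integral i1 tendsto_neg_atTop_atBot tendsto_id
  -- The vertical sides of the rectangle have fixed length `|η|` and integrand at most `C / (1 +
  -- R^2)`. Leaving the abscissa `s R = ±R` open treats both sides at once.
  have hside : ∀ s : ℝ → ℝ, (∀ R, s R ^ 2 = R ^ 2) →
      Tendsto (fun R : ℝ => ∫ y : ℝ in (0 : ℝ)..η, h (s R + y * I)) atTop (𝓝 0) := by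
    intro s hs
    have hlim : Tendsto (fun R : ℝ => C * (1 + R ^ 2)⁻¹ * |η - 0|) atTop (𝓝 0) := by
      have : Tendsto (fun R : ℝ => (1 + R ^ 2)⁻¹) atTop (𝓝 0) :=
        (tendsto_atTop_add_const_left _ _ (tendsto_pow_atTop two_ne_zero)).inv_tendsto_atTop
      simpa using (this.const_mul C).mul_const |η - 0|
    refine squeeze_zero_norm (fun R => ?_) hlim
    refine intervalIntegral.norm_integral_le_of_norm_le_const fun y hy => ?_
    rw [← hs R]
    refine hb _ _ ?_
    rcases le_total 0 η with h0 | h0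
    · rw [Set.uIoc_of_le h0] at hy
      rw [abs_of_pos hy.1, abs_of_nonneg h0]; exact hy.2
    · rw [Set.uIoc_of_ge h0] at hy
      rw [abs_of_nonpos hy.2, abs_of_nonpos h0]; linarith [hy.1]
  -- Cauchy's theorem for the rectangle with opposite corners `-R` and `R + ηi`.
  have key : ∀ R : ℝ, (∫ x : ℝ in -R..R, h x) - (∫ x : ℝ in -R..R, h (x + η * I))
      + I * (∫ y : ℝ in (0 : ℝ)..η, h ((R : ℝ) + y * I))
      - I * (∫ y : ℝ in (0 : ℝ)..η, h ((-R : ℝ) + y * I)) = 0 := by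
    intro R
    have := integral_boundary_rect_eq_zero_of_differentiableOn h ((-R : ℝ) : ℂ) (R + η * I)
      hd.differentiableOn
    simpa using this
  have lim := ((t0.sub t1).add ((hside (fun R => R) fun R => rfl).const_mul I)).sub
    ((hside (fun R => -R) fun R => by ring).const_mul I)
  have lim0 := lim.congr key
  have := tendsto_nhds_unique lim0 tendsto_const_nhds
  simp only [mul_zero, add_zero, sub_zero] at this
  exact (sub_eq_zero.1 this).symm

variable {a : ℝ} {g : ℂ → ℂ}

/-- The case `N = 2` is enough for an integrable majorant on every horizontal line. -/
theorem PaleyWienerBound.exists_sq_bound (hb : PaleyWienerBound a g) : ∃ C : ℝ, 0 ≤ C ∧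
    ∀ ζ : ℂ, ‖g ζ‖ ≤ C * (1 + ζ.re ^ 2)⁻¹ * Real.exp (a * |ζ.im|) := by
  obtain ⟨C, hC⟩ := hb 2
  have hC0 : 0 ≤ C := by
    have := (mul_nonneg (norm_nonneg _) (by positivity)).trans (hC 0)
    simpa using this
  refine ⟨C, hC0, fun ζ => ?_⟩
  have h1 : 1 + ζ.re ^ 2 ≤ (1 + ‖ζ‖) ^ 2 := by
    have h2 : ζ.re ^ 2 ≤ ‖ζ‖ ^ 2 := by
      rw [← sq_abs ζ.re]; gcongr; exact abs_re_le_norm ζ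
    nlinarith [norm_nonneg ζ]
  have h3 := (mul_le_mul_of_nonneg_left h1 (norm_nonneg (g ζ))).trans (hC ζ)
  rw [mul_right_comm, ← div_eq_mul_inv, le_div_iff₀ (by positivity)]
  exact h3

/-- The inverse of the Fourier--Laplace transform. -/
def invLaplace (g : ℂ → ℂ) : ℝ → ℂ := 𝓕⁻ fun v : ℝ => g (2 * Real.pi * v)

/-- The kernel of `𝓕` is `e^{-2πivx}`; this is the source of the factor `2π` here and in
`invLaplace`. -/
theorem fourier_eq_laplace (f : ℝ → ℂ) : 𝓕 f = fun v : ℝ => laplace f (2 * Real.pi * v) := by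
  funext w
  rw [Real.fourier_real_eq_integral_exp_smul, laplace]
  congr 1
  funext v
  rw [smul_eq_mul, mul_comm]
  congr 2
  push_cast
  ring

theorem norm_le_inv_one_add_sq_of_two_pi {C : ℝ} (hC0 : 0 ≤ C) (v : ℝ) :
    C * (1 + (2 * Real.pi * v) ^ 2)⁻¹ ≤ C * (1 + v ^ 2)⁻¹ := by
  have h1 : v ^ 2 ≤ (2 * Real.pi * v) ^ 2 := by
    rw [mul_pow]
    have : 1 ≤ (2 * Real.pi) ^ 2 := one_le_pow₀ (by linarith [Real.pi_gt_three])
    nlinarith [sq_nonneg v]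
  gcongr

theorem PaleyWienerBound.contDiff_invLaplace (hd : Differentiable ℂ g)
    (hb : PaleyWienerBound a g) : ContDiff ℝ ∞ (invLaplace g) := by
  have hc := hd.continuous
  rw [invLaplace, Real.fourierInv_eq_fourier_comp_neg]
  refine Real.contDiff_fourier fun k _ => ?_
  -- Of the `k + 2` powers, `k` absorb `|v|^k` and two leave the integrable factor `1 / (1 + v^2)`.
  obtain ⟨C, hC⟩ := hb (k + 2)
  refine Integrable.norm (f := fun v : ℝ => ((v : ℂ) ^ k * g (2 * Real.pi * (-v : ℝ))))
    (integrable_of_norm_le_inv_one_add_sq (by fun_prop) (C := C) fun v => ?_) |>.congr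
      (Eventually.of_forall fun v => by simp)
  have h := hC (2 * Real.pi * (-v : ℝ))
  have h0 : (2 * Real.pi * (-v : ℝ) : ℂ).im = 0 := by
    rw [← ofReal_ofNat, ← ofReal_mul, ← ofReal_mul, ofReal_im]
  have hn : |v| ≤ ‖(2 * Real.pi * (-v : ℝ) : ℂ)‖ := by
    have : 1 ≤ 2 * Real.pi := by linarith [Real.pi_gt_three]
    rw [← ofReal_ofNat, ← ofReal_mul, ← ofReal_mul, norm_real, Real.norm_eq_abs, abs_mul, abs_neg,
      abs_of_pos Real.two_pi_pos]
    nlinarith [abs_nonneg v]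
  rw [h0, abs_zero, mul_zero, Real.exp_zero, mul_one] at h
  rw [norm_mul, norm_pow, norm_real, Real.norm_eq_abs, ← div_eq_mul_inv,
    le_div_iff₀ (by positivity)]
  refine le_trans ?_ h
  rw [pow_add, mul_comm (|v| ^ k), mul_assoc]
  have h2 : 1 + v ^ 2 ≤ (1 + ‖(2 * Real.pi * (-v : ℝ) : ℂ)‖) ^ 2 := by
    rw [← sq_abs v]; nlinarith [abs_nonneg v]
  have h3 : |v| ≤ 1 + ‖(2 * Real.pi * (-v : ℝ) : ℂ)‖ := by linarith
  gcongr

/-- Shifting the inversion integral to height `η` bounds it by a constant times `e^{2π(a|η| - xη)}`.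
For `x > a` this tends to zero as `η → ∞`, and for `x < -a` as `η → -∞`. -/
theorem PaleyWienerBound.invLaplace_eq_zero (hd : Differentiable ℂ g)
    (hb : PaleyWienerBound a g) {x : ℝ} (hx : x ∉ Set.Icc (-a) a) : invLaplace g x = 0 := by
  obtain ⟨C, hC0, hC⟩ := hb.exists_sq_bound
  set h : ℂ → ℂ := fun w => g (2 * Real.pi * w) * cexp (I * (2 * Real.pi * w) * x) with hh
  have hhd : Differentiable ℂ h := by
    have h1 : Differentiable ℂ fun w : ℂ => g (2 * Real.pi * w) :=
      hd.comp (differentiable_id.const_mul _)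
    exact h1.mul (by fun_prop)
  have hf : invLaplace g x = ∫ v : ℝ, h v := by
    rw [invLaplace, Real.fourierInv_eq_fourier_neg, Real.fourier_real_eq_integral_exp_smul]
    congr 1
    funext v
    rw [smul_eq_mul, mul_comm, hh]
    congr 2
    push_cast
    ring
  have hbound : ∀ ξ y : ℝ, ‖h (ξ + y * I)‖
      ≤ C * Real.exp (2 * Real.pi * (a * |y| - x * y)) * (1 + ξ ^ 2)⁻¹ := by
    intro ξ y
    have hre : (2 * Real.pi * (ξ + y * I) : ℂ).re = 2 * Real.pi * ξ := by simp
    have him : (2 * Real.pi * (ξ + y * I) : ℂ).im = 2 * Real.pi * y := by simp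
    have h1 := hC (2 * Real.pi * (ξ + y * I))
    rw [hre, him, abs_mul, abs_of_pos Real.two_pi_pos] at h1
    have h2 : ‖cexp (I * (2 * Real.pi * (ξ + y * I)) * x)‖
        = Real.exp (-(2 * Real.pi * y * x)) := by
      rw [norm_exp]; congr 1; simp
    rw [hh]
    simp only [norm_mul _ (cexp _)]
    rw [h2]
    calc _ ≤ C * (1 + ξ ^ 2)⁻¹ * Real.exp (a * (2 * Real.pi * |y|))
            * Real.exp (-(2 * Real.pi * y * x)) := by
          gcongr
          refine h1.trans ?_
          gcongr ?_ * _
          exact norm_le_inv_one_add_sq_of_two_pi hC0 ξ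
      _ = _ := by
          rw [mul_assoc, ← Real.exp_add, mul_right_comm]
          congr 3
          ring
  have hshift : ∀ η : ℝ, ‖∫ v : ℝ, h v‖
      ≤ C * Real.exp (2 * Real.pi * (a * |η| - x * η)) * Real.pi := by
    intro η
    -- This constant is crude: it only has to be uniform on the strip `|y| ≤ |η|`, to permit the
    -- shift. The sharp bound on the shifted line is `hbound v η`.
    rw [← integral_horizontal_shift hhd (η := η)
      (C := C * Real.exp (2 * Real.pi * ((|a| + |x|) * |η|)))]
    · have h1 := norm_integral_le_of_norm_le (integrable_inv_one_add_sq.const_mul _)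
        (Eventually.of_forall fun v => hbound v η)
      rwa [integral_const_mul, integral_univ_inv_one_add_sq] at h1
    · intro ξ y hy
      refine (hbound ξ y).trans ?_
      gcongr
      have h1 : a * |y| ≤ |a| * |η| :=
        mul_le_mul (le_abs_self a) hy (abs_nonneg _) (abs_nonneg _)
      have h2 : -(x * y) ≤ |x| * |η| := by
        calc -(x * y) ≤ |x * y| := neg_le_abs _
          _ = |x| * |y| := abs_mul _ _
          _ ≤ |x| * |η| := by gcongr
      linarith
  -- `s t` is the height of the shifted line, and `δ` is the distance from `x` to `[-a, a]`.
  have hlim : ∀ s : ℝ → ℝ, (∃ δ : ℝ, 0 < δ ∧ ∀ t, 0 ≤ t → a * |s t| - x * s t = -(δ * t)) →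
      ∫ v : ℝ, h v = 0 := by
    rintro s ⟨δ, hδ, hs⟩
    have ht : Tendsto (fun t : ℝ => C * Real.exp (-((2 * Real.pi * δ) * t)) * Real.pi) atTop
        (𝓝 0) := by
      have h1 : Tendsto (fun t : ℝ => Real.exp (-((2 * Real.pi * δ) * t))) atTop (𝓝 0) :=
        Real.tendsto_exp_neg_atTop_nhds_zero.comp
          (tendsto_id.const_mul_atTop (by positivity : 0 < 2 * Real.pi * δ))
      simpa using (h1.const_mul C).mul_const Real.pi
    refine norm_le_zero_iff.1 (ge_of_tendsto ht ?_)
    filter_upwards [eventually_ge_atTop 0] with t ht0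
    have := hshift (s t)
    rwa [hs t ht0, mul_neg, ← mul_assoc] at this
  rw [hf]
  rw [Set.mem_Icc, not_and_or, not_le, not_le] at hx
  rcases hx with hx | hx
  · exact hlim (fun t => -t) ⟨-x - a, by linarith, fun t ht => by
      rw [abs_neg, abs_of_nonneg ht]; ring⟩
  · exact hlim (fun t => t) ⟨x - a, by linarith, fun t ht => by
      rw [abs_of_nonneg ht]; ring⟩

theorem PaleyWienerBound.tsupport_invLaplace (hd : Differentiable ℂ g)
    (hb : PaleyWienerBound a g) : tsupport (invLaplace g) ⊆ Set.Icc (-a) a := by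
  refine closure_minimal (fun x hx => ?_) isClosed_Icc
  by_contra h
  exact hx (hb.invLaplace_eq_zero hd h)

theorem PaleyWienerBound.integrable (hd : Differentiable ℂ g) (hb : PaleyWienerBound a g) :
    Integrable fun v : ℝ => g (2 * Real.pi * v) := by
  obtain ⟨C, hC0, hC⟩ := hb.exists_sq_bound
  have hc := hd.continuous
  refine integrable_of_norm_le_inv_one_add_sq (by fun_prop) (C := C) fun v => ?_
  have h := hC (2 * Real.pi * v)
  rw [← ofReal_ofNat, ← ofReal_mul, ← ofReal_mul, ofReal_re, ofReal_im, abs_zero, mul_zero,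
    Real.exp_zero, mul_one] at h
  have h2 := h.trans (norm_le_inv_one_add_sq_of_two_pi hC0 v)
  simpa using h2

theorem invLaplace_laplace {f : ℝ → ℂ} (hf : ContDiff ℝ ∞ f)
    (hs : tsupport f ⊆ Set.Icc (-a) a) : invLaplace (laplace f) = f := by
  rw [invLaplace, ← fourier_eq_laplace]
  refine hf.continuous.fourierInv_fourier_eq
    (hf.continuous.integrable_of_hasCompactSupport (hasCompactSupport_of_tsupport_subset hs)) ?_
  rw [fourier_eq_laplace]
  exact (paleyWienerBound_laplace hf hs).integrable (differentiable_laplace hf.continuous hs)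

/-- Fourier inversion gives equality on the real line only; both sides are entire, so the identity
theorem does the rest. -/
theorem PaleyWienerBound.laplace_invLaplace (hd : Differentiable ℂ g)
    (hb : PaleyWienerBound a g) : laplace (invLaplace g) = g := by
  have hsm := hb.contDiff_invLaplace hd
  have hs := hb.tsupport_invLaplace hd
  have hc := hd.continuous
  have hfi : Integrable (invLaplace g) :=
    hsm.continuous.integrable_of_hasCompactSupport (hasCompactSupport_of_tsupport_subset hs)
  -- This Fourier transform is the reflection of `invLaplace g`, which is continuous with compact
  -- support.
  have hG : Integrable (𝓕 fun v : ℝ => g (2 * Real.pi * v)) := by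
    have h1 := hfi.comp_neg
    refine h1.congr (Eventually.of_forall fun v => ?_)
    simp only [invLaplace]
    rw [Real.fourierInv_eq_fourier_neg, neg_neg]
  have hinv : 𝓕 (invLaplace g) = fun v : ℝ => g (2 * Real.pi * v) :=
    Continuous.fourier_fourierInv_eq (by fun_prop) (hb.integrable hd) hG
  rw [fourier_eq_laplace] at hinv
  have e1 : AnalyticOnNhd ℂ (laplace (invLaplace g)) Set.univ :=
    (differentiable_laplace hsm.continuous hs).differentiableOn.analyticOnNhd isOpen_univ
  have e2 : AnalyticOnNhd ℂ g Set.univ := hd.differentiableOn.analyticOnNhd isOpen_univ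
  refine e1.eq_of_frequently_eq e2 (z₀ := 0) ?_
  -- The nonzero real points `2π / (k + 1)` accumulate at the origin.
  have hseq : Tendsto (fun k : ℕ => (2 * Real.pi * ((1 / ((k : ℝ) + 1) : ℝ) : ℂ) : ℂ)) atTop
      (𝓝[≠] 0) := by
    refine tendsto_nhdsWithin_iff.2 ⟨?_, Eventually.of_forall fun k => ?_⟩
    · have h1 : Tendsto (fun k : ℕ => ((1 / ((k : ℝ) + 1) : ℝ) : ℂ)) atTop (𝓝 0) := by
        have := (continuous_ofReal.tendsto 0).comp
          (tendsto_one_div_add_atTop_nhds_zero_nat (𝕜 := ℝ))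
        rwa [ofReal_zero] at this
      simpa using h1.const_mul (2 * Real.pi : ℂ)
    · have h1 : (1 / ((k : ℝ) + 1)) ≠ 0 := by positivity
      have h2 : (Real.pi : ℂ) ≠ 0 := ofReal_ne_zero.2 Real.pi_ne_zero
      simp only [Set.mem_compl_iff, Set.mem_singleton_iff]
      exact mul_ne_zero (mul_ne_zero two_ne_zero h2) (ofReal_ne_zero.2 h1)
  exact hseq.frequently (Frequently.of_forall fun k => congrFun hinv _)

end PaleyWiener

/-! ## Ordered monomials in anticommuting elements -/

section Monomials

variable {R : Type*} [Ring R] {n : ℕ}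

/-- The ordered product of the `e i` with `i ∈ K`. -/
def mon (e : Fin n → R) (K : Finset (Fin n)) : R :=
  ((List.finRange n).map fun i => if i ∈ K then e i else 1).prod

theorem mon_empty (e : Fin n → R) : mon e ∅ = 1 := by
  refine List.prod_eq_one fun x hx => ?_
  obtain ⟨i, -, rfl⟩ := List.mem_map.1 hx
  simp

theorem mon_univ (e : Fin n → R) : mon e Finset.univ = (List.ofFn e).prod := by
  simp [mon, List.ofFn_eq_map]

theorem map_mon {S F : Type*} [Ring S] [FunLike F R S] [RingHomClass F R S] (φ : F)
    (e : Fin n → R) (K : Finset (Fin n)) : φ (mon e K) = mon (fun i => φ (e i)) K := by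
  rw [mon, map_list_prod, List.map_map, mon]
  congr 2
  funext i
  by_cases h : i ∈ K <;> simp [h]

/-- Each factor crossed contributes its own sign. Allowing the sign to depend on `j` covers
commuting, anticommuting and mixed situations together. -/
theorem mul_mon_of_semicomm {x : R} {e : Fin n → R} {ε : Fin n → ℤˣ}
    (h : ∀ j, x * e j = ε j • (e j * x)) (K : Finset (Fin n)) :
    x * mon e K = (∏ j ∈ K, ε j) • (mon e K * x) := by
  have key : ∀ L : List (Fin n), x * (L.map fun i => if i ∈ K then e i else 1).prod
      = (L.map fun i => if i ∈ K then ε i else 1).prod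
        • ((L.map fun i => if i ∈ K then e i else 1).prod * x) := by
    intro L
    induction L with
    | nil => simp
    | cons j L ih =>
      simp only [List.map_cons, List.prod_cons]
      by_cases hj : j ∈ K
      · simp only [hj, if_true]
        rw [← mul_assoc, h, smul_mul_assoc, mul_assoc, ih, mul_smul_comm, smul_smul, mul_assoc]
      · simp only [hj, if_false, one_mul]
        rw [ih]
  have h2 : ((List.finRange n).map fun i => if i ∈ K then ε i else 1).prod = ∏ j ∈ K, ε j := by
    rw [← List.ofFn_eq_map, List.prod_ofFn, Finset.prod_ite_mem, Finset.univ_inter]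
  rw [mon, key, h2]

theorem mul_mon_of_comm {x : R} {e : Fin n → R} (h : ∀ j, x * e j = e j * x)
    (K : Finset (Fin n)) : x * mon e K = mon e K * x := by
  simpa using mul_mon_of_semicomm (x := x) (e := e) (ε := fun _ => 1) (by simpa using h) K

theorem mul_mon_of_anticomm {x : R} {e : Fin n → R} (h : ∀ j, x * e j = -(e j * x))
    (K : Finset (Fin n)) : x * mon e K = (-1 : ℤˣ) ^ K.card • (mon e K * x) := by
  simpa using mul_mon_of_semicomm (ε := fun _ => -1) (by simpa using h) K

variable {e : Fin n → R} {z : R}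

theorem gen_mul_mon_of_notMem (hanti : ∀ i j, i ≠ j → e i * e j = -(e j * e i)) {i : Fin n}
    {K : Finset (Fin n)} (hi : i ∉ K) :
    e i * mon e K = (-1 : ℤˣ) ^ K.card • (mon e K * e i) := by
  -- The generator `e i` commutes with itself, so its sign is `1`; since `i ∉ K`, that sign never
  -- enters the product.
  have h := mul_mon_of_semicomm (x := e i) (e := e) (ε := fun j => if j = i then 1 else -1)
    (fun j => by
      by_cases hj : j = i
      · simp [hj]
      · simp [hj, hanti i j (Ne.symm hj)]) K
  rw [h]
  congr 1
  rw [← Finset.prod_const]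
  refine Finset.prod_congr rfl fun _ hj => ?_
  rw [if_neg]
  rintro rfl
  exact hi hj

/-- Anticommuting elements with the same square `z`. -/
structure IsCliffordFamily (e : Fin n → R) (z : R) : Prop where
  anticomm : ∀ i j, i ≠ j → e i * e j = -(e j * e i)
  sq : ∀ i, e i * e i = z

namespace IsCliffordFamily

theorem z_comm (h : IsCliffordFamily e z) (i : Fin n) : e i * z = z * e i := by
  rw [← h.sq i, mul_assoc]

-- Moving `e i` to its slot costs a sign for each factor crossed. There it either fills an empty
-- slot or meets another `e i` and leaves the central `z`. The sign stays unspecified because only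
-- its invertibility is used later.
open scoped symmDiff in
theorem gen_mul_mon (h : IsCliffordFamily e z) (i : Fin n) (K : Finset (Fin n)) :
    ∃ s : ℤˣ, e i * mon e K = s • (z ^ (if i ∈ K then 1 else 0) * mon e (K ∆ {i})) := by
  set f : Finset (Fin n) → Fin n → R := fun K j => if j ∈ K then e j else 1 with hf
  have hne : ∀ j, j ≠ i → f (K ∆ {i}) j = f K j := by
    intro j hj
    simp [hf, Finset.mem_symmDiff, hj]
  have key : ∀ L : List (Fin n), L.Nodup → i ∈ L → ∃ s : ℤˣ, e i * (L.map (f K)).prod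
      = s • (z ^ (if i ∈ K then 1 else 0) * (L.map (f (K ∆ {i}))).prod) := by
    intro L hL hi
    induction L with
    | nil => simp at hi
    | cons j L ih =>
      rw [List.nodup_cons] at hL
      simp only [List.map_cons, List.prod_cons]
      by_cases hj : j = i
      · subst hj
        have hmap : L.map (f (K ∆ {j})) = L.map (f K) :=
          List.map_congr_left fun k hk => hne k (fun hkj => hL.1 (hkj ▸ hk))
        rw [hmap]
        refine ⟨1, ?_⟩
        by_cases hjK : j ∈ K
        · simp [hf, hjK, Finset.mem_symmDiff, ← mul_assoc, h.sq]
        · simp [hf, hjK, Finset.mem_symmDiff]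
      · obtain ⟨s, hs⟩ := ih hL.2 ((List.mem_cons.1 hi).resolve_left (Ne.symm hj))
        rw [hne j hj]
        by_cases hjK : j ∈ K
        · refine ⟨-s, ?_⟩
          have hzj : e j * z ^ (if i ∈ K then 1 else 0) = z ^ (if i ∈ K then 1 else 0) * e j :=
            ((show Commute (e j) z from h.z_comm j).pow_right _)
          simp only [hf, hjK, if_true] at hs ⊢
          rw [← mul_assoc, h.anticomm i j (Ne.symm hj), neg_mul, mul_assoc, hs, mul_smul_comm,
            ← mul_assoc, hzj, mul_assoc, Units.neg_smul]
        · refine ⟨s, ?_⟩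
          simp only [hf, hjK, if_false, one_mul] at hs ⊢
          exact hs
  exact key _ (List.nodup_finRange n) (List.mem_finRange i)

open scoped symmDiff in
theorem exists_mon_insert (h : IsCliffordFamily e z) {i : Fin n} {K : Finset (Fin n)}
    (hi : i ∉ K) : ∃ s : ℤˣ, e i * mon e K = s • mon e (insert i K) := by
  obtain ⟨s, hs⟩ := h.gen_mul_mon i K
  have h1 : K ∆ {i} = insert i K := by
    ext j
    by_cases hj : j = i
    · simp [Finset.mem_symmDiff, hj, hi]
    · simp [Finset.mem_symmDiff, hj]
  exact ⟨s, by simpa [hi, h1] using hs⟩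

-- Multiplying by the generators of `J` one at a time, each index common to `J` and `K` turns into a
-- factor `z` and every other index survives.
open scoped symmDiff in
theorem mon_mul_mon (h : IsCliffordFamily e z) (J K : Finset (Fin n)) :
    ∃ s : ℤˣ, mon e J * mon e K = s • (z ^ (J ∩ K).card * mon e (J ∆ K)) := by
  induction J using Finset.induction_on with
  | empty =>
    have h0 : ∅ ∆ K = K := by ext; simp [Finset.mem_symmDiff]
    exact ⟨1, by simp [mon_empty, h0]⟩
  | insert i J hi ih =>
    obtain ⟨s, hs⟩ := ih
    obtain ⟨r, hr⟩ := h.exists_mon_insert hi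
    obtain ⟨t, ht⟩ := h.gen_mul_mon i (J ∆ K)
    have hr' : mon e (insert i J) = r⁻¹ • (e i * mon e J) := by rw [hr, inv_smul_smul]
    have hz : e i * z ^ (J ∩ K).card = z ^ (J ∩ K).card * e i :=
      (show Commute (e i) z from h.z_comm i).pow_right _
    refine ⟨r⁻¹ * (s * t), ?_⟩
    have hsd : (J ∆ K) ∆ {i} = insert i J ∆ K := by
      ext j
      by_cases hj : j = i
      · subst hj; simp [Finset.mem_symmDiff, hi]
      · simp [Finset.mem_symmDiff, hj]
    have hcard : (insert i J ∩ K).card = (J ∩ K).card + if i ∈ J ∆ K then 1 else 0 := by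
      by_cases hiK : i ∈ K
      · rw [Finset.insert_inter_of_mem hiK, Finset.card_insert_of_notMem (by simp [hi])]
        simp [Finset.mem_symmDiff, hi, hiK]
      · rw [Finset.insert_inter_of_notMem hiK]
        simp [Finset.mem_symmDiff, hi, hiK]
    rw [hr', smul_mul_assoc, mul_assoc, hs, mul_smul_comm, ← mul_assoc, hz, mul_assoc, ht,
      mul_smul_comm, ← mul_assoc, ← pow_add, hsd, hcard, smul_smul, smul_smul, mul_assoc]

theorem mon_compl_mul_mon (h : IsCliffordFamily e z) (K : Finset (Fin n)) :
    ∃ s : ℤˣ, mon e Kᶜ * mon e K = s • mon e Finset.univ := by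
  obtain ⟨s, hs⟩ := h.mon_mul_mon Kᶜ K
  refine ⟨s, ?_⟩
  rw [hs]
  congr 1
  have h1 : Kᶜ ∩ K = ∅ := by ext; simp
  have h2 : symmDiff Kᶜ K = Finset.univ := by simp
  rw [h1, h2]
  simp

end IsCliffordFamily

end Monomials

/-! ## The monomial basis of the enveloping algebra -/

section Env

variable {V : Type*} [NormedAddCommGroup V] [InnerProductSpace ℝ V] {n : ℕ}

theorem ι_mk (v : V) (t : ℝ) : (ι (v, t) : Env V) = ι (v, 0) + t • zElt := by
  rw [zElt, ← map_smul, ← map_add]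
  simp

/-- The algebra is a quotient of a tensor algebra, so everything is reached from `1` by left
multiplication with elements of `hc` and linear combinations. -/
theorem env_induction {p : Env V → Prop} (one : p 1) (add : ∀ u v, p u → p v → p (u + v))
    (smul : ∀ (c : ℝ) u, p u → p (c • u)) (mul : ∀ x u, p u → p (ι x * u)) (u : Env V) : p u := by
  let φ : TensorAlgebra ℝ (HC V) →ₐ[ℝ] Env V := RingQuot.mkAlgHom ℝ (EnvRel V)
  -- Stating the claim for left multiplication by `φ t` lets products of tensors be handled by
  -- composition.
  have key : ∀ (t : TensorAlgebra ℝ (HC V)) (u : Env V), p u →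
      p (φ t * u) := by
    intro t
    induction t using TensorAlgebra.induction with
    | algebraMap r =>
      intro u hu
      rw [AlgHom.commutes, ← Algebra.smul_def]
      exact smul r u hu
    | ι x => exact fun u hu => mul x u hu
    | mul a b ha hb =>
      intro u hu
      rw [map_mul, mul_assoc]
      exact ha _ (hb _ hu)
    | add a b ha hb =>
      intro u hu
      rw [map_add, add_mul]
      exact add _ _ (ha _ hu) (hb _ hu)
  obtain ⟨t, rfl⟩ := RingQuot.mkAlgHom_surjective ℝ (EnvRel V) u
  have := key t 1 one
  rwa [mul_one] at this

theorem zElt_comm (u : Env V) : zElt * u = u * zElt := by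
  induction u using env_induction with
  | one => simp
  | add u v hu hv => rw [mul_add, add_mul, hu, hv]
  | smul c u hu => rw [mul_smul_comm, smul_mul_assoc, hu]
  | mul x u hu => rw [← mul_assoc, zElt, ι_even_comm, mul_assoc, ← zElt, hu, mul_assoc]

/-- The images of the basis vectors in the enveloping algebra. -/
def gen (b : OrthonormalBasis (Fin n) ℝ V) (i : Fin n) : Env V := ι (b i, 0)

theorem isCliffordFamily_gen (b : OrthonormalBasis (Fin n) ℝ V) :
    IsCliffordFamily (gen b) zElt where
  anticomm i j hij := by
    have h := ι_odd_odd (b i) (b j)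
    rw [b.inner_eq_zero hij, mul_zero, ← Prod.zero_eq_mk, map_zero] at h
    exact eq_neg_of_add_eq_zero_left h
  sq i := by
    have h := ι_odd_odd (b i) (b i)
    rw [b.inner_eq_one, mul_one, ι_mk 0 2, ← Prod.zero_eq_mk, map_zero, zero_add, ← two_smul ℝ] at h
    exact smul_right_injective _ (two_ne_zero' ℝ) h

/-- The monomials `z^k a_K` span the enveloping algebra. -/
theorem env_induction_mon (b : OrthonormalBasis (Fin n) ℝ V) {p : Env V → Prop}
    (mon : ∀ (k : ℕ) K, p (zElt ^ k * mon (gen b) K)) (add : ∀ u v, p u → p v → p (u + v))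
    (smul : ∀ (c : ℝ) u, p u → p (c • u)) (u : Env V) : p u := by
  have zero : p 0 := by simpa using smul 0 _ (mon 0 ∅)
  let S : Submodule ℝ (Env V) := Submodule.span ℝ
    (Set.range fun q : ℕ × Finset (Fin n) => zElt ^ q.1 * HeisenbergClifford.mon (gen b) q.2)
  have hmem : ∀ (k : ℕ) K, zElt ^ k * HeisenbergClifford.mon (gen b) K ∈ S :=
    fun k K => Submodule.subset_span ⟨(k, K), rfl⟩
  have hsub : ∀ u ∈ S, p u := by
    intro u hu
    induction hu using Submodule.span_induction with
    | mem x hx => obtain ⟨q, rfl⟩ := hx; exact mon q.1 q.2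
    | zero => exact zero
    | add x y _ _ hx hy => exact add x y hx hy
    | smul c x _ hx => exact smul c x hx
  refine hsub u ?_
  -- The span contains `1` and is stable under left multiplication by `hc`, hence is everything.
  induction u using env_induction with
  | one => simpa [mon_empty] using hmem 0 ∅
  | add u v hu hv => exact S.add_mem hu hv
  | smul c u hu => exact S.smul_mem c hu
  | mul x u hu =>
    induction hu using Submodule.span_induction with
    | zero => rw [mul_zero]; exact S.zero_mem
    | add u v _ _ hu hv => rw [mul_add]; exact S.add_mem hu hv
    | smul c u _ hu => rw [mul_smul_comm]; exact S.smul_mem c hu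
    | mem u hu =>
      obtain ⟨⟨k, K⟩, rfl⟩ := hu
      have hx : ι x = ∑ i, b.repr x.1 i • gen b i + x.2 • (zElt : Env V) := by
        have h1 : (ι (x.1, 0) : Env V) = ∑ i, b.repr x.1 i • gen b i := by
          conv_lhs => rw [← b.sum_repr x.1]
          have h2 : ((∑ i, b.repr x.1 i • b i, 0) : HC V)
              = ∑ i, b.repr x.1 i • ((b i, 0) : HC V) := by
            ext <;> simp [Prod.fst_sum, Prod.snd_sum]
          rw [h2, map_sum]
          exact Finset.sum_congr rfl fun i _ => map_smul _ _ _
        rw [← h1, ← ι_mk]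
      rw [hx, add_mul, Finset.sum_mul]
      refine S.add_mem (S.sum_mem fun i _ => ?_) ?_
      · obtain ⟨s, hs⟩ := (isCliffordFamily_gen b).gen_mul_mon i K
        have hz : gen b i * zElt ^ k = zElt ^ k * gen b i :=
          (show Commute (gen b i) zElt from (zElt_comm _).symm).pow_right _
        simp only
        rw [smul_mul_assoc, ← mul_assoc, hz, mul_assoc, hs, mul_smul_comm, ← mul_assoc, ← pow_add,
          Units.smul_def]
        exact S.smul_mem _ (zsmul_mem (hmem _ _) _)
      · simp only
        rw [smul_mul_assoc, ← mul_assoc, ← pow_succ']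
        exact S.smul_mem _ (hmem _ _)

theorem parity_mon (b : OrthonormalBasis (Fin n) ℝ V) (K : Finset (Fin n)) :
    ∃ s : ℤˣ, parity (mon (gen b) K) = s • mon (gen b) K := by
  induction K using Finset.induction_on with
  | empty => exact ⟨1, by simp [mon_empty]⟩
  | insert i K hi ih =>
    obtain ⟨s, hs⟩ := ih
    obtain ⟨r, hr⟩ := (isCliffordFamily_gen b).exists_mon_insert hi
    refine ⟨-s, ?_⟩
    have hr' : mon (gen b) (insert i K) = r⁻¹ • (gen b i * mon (gen b) K) := by
      rw [hr, inv_smul_smul]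
    have hp : parity (gen b i) = -gen b i := parity_odd (b i)
    rw [hr', Units.smul_def, map_zsmul, map_mul, hs, hp, ← Units.smul_def, neg_mul, mul_smul_comm,
      Units.neg_smul, smul_neg]
    exact congrArg _ (smul_comm _ _ _)

theorem units_smul_tmul {A B : Type*} [Ring A] [Algebra ℝ A] [Ring B] [Algebra ℝ B] (s : ℤˣ)
    (x : A) (y : B) : (s • x) ⊗ₜ[ℝ] y = s • (x ⊗ₜ[ℝ] y) := by
  rcases Int.units_eq_one_or s with rfl | rfl <;> simp [TensorProduct.neg_tmul]

theorem tmul_units_smul {A B : Type*} [Ring A] [Algebra ℝ A] [Ring B] [Algebra ℝ B] (s : ℤˣ)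
    (x : A) (y : B) : x ⊗ₜ[ℝ] (s • y) = s • (x ⊗ₜ[ℝ] y) := by
  rcases Int.units_eq_one_or s with rfl | rfl <;> simp [TensorProduct.tmul_neg]

/-- Each factor `a_i ⊗ 1 + 1 ⊗ a_i` sends `i` to the left or to the right, so the expansion runs
over the subset `I` of indices sent left. Signs come from passing `a_i` across the left factor and
from restoring the increasing order. -/
theorem coprodMul_list_prod (b : OrthonormalBasis (Fin n) ℝ V) (L : List (Fin n))
    (hL : L.Nodup) : ∃ s : Finset (Fin n) → ℤˣ,
      coprodMul (L.map (gen b)).prod (1 ⊗ₜ 1) = ∑ I ∈ L.toFinset.powerset,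
        s I • (mon (gen b) I ⊗ₜ[ℝ] mon (gen b) (L.toFinset \ I)) := by
  have hC := isCliffordFamily_gen b
  induction L with
  | nil => exact ⟨1, by simp [mon_empty]⟩
  | cons i L ih =>
    rw [List.nodup_cons] at hL
    obtain ⟨s, hs⟩ := ih hL.2
    have hi : i ∉ L.toFinset := by simpa using hL.1
    choose! r hr using fun K (hK : i ∉ K) => hC.exists_mon_insert (K := K) hK
    choose q hq using parity_mon b
    -- If `i` went left, the term comes from `I.erase i`, with the sign `r` of reordering. If it
    -- went right, the parity sign `q` of the left monomial appears as well.
    refine ⟨fun I => if i ∈ I then s (I.erase i) * r (I.erase i)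
      else s I * (q I * r (L.toFinset \ I)), ?_⟩
    rw [List.toFinset_cons, Finset.sum_powerset_insert hi, List.map_cons, List.prod_cons, map_mul,
      Module.End.mul_apply, hs, map_sum, ← Finset.sum_add_distrib]
    refine Finset.sum_congr rfl fun I hI => ?_
    have hIL := Finset.mem_powerset.1 hI
    have hiI : i ∉ I := fun h => hi (hIL h)
    have h1 : insert i L.toFinset \ I = insert i (L.toFinset \ I) :=
      Finset.insert_sdiff_of_notMem _ hiI
    have h2 : insert i L.toFinset \ insert i I = L.toFinset \ I := by
      ext j
      by_cases hj : j = i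
      · subst hj; simp [hL.1]
      · simp [hj]
    have hm : coprodMul (gen b i) = coprodAux (b i, 0) := by
      rw [coprodMul, gen, lift_ι]
    rw [h1, h2, hm, Units.smul_def, map_zsmul, ← Units.smul_def, coprodAux_odd,
      show (ι (b i, 0) : Env V) = gen b i from rfl, hr I hiI, hq I,
      hr (L.toFinset \ I) (by simp [hL.1])]
    simp only [hiI, if_false, Finset.mem_insert_self, if_true, Finset.erase_insert hiI,
      units_smul_tmul, tmul_units_smul, smul_add, smul_smul]
    rw [add_comm, mul_comm (q I)]

theorem coprod_gammaElt (b : OrthonormalBasis (Fin n) ℝ V) : ∃ s : Finset (Fin n) → ℤˣ,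
    coprod (gammaElt b) = ∑ I, s I • (mon (gen b) I ⊗ₜ[ℝ] mon (gen b) Iᶜ) := by
  obtain ⟨s, hs⟩ := coprodMul_list_prod b (List.finRange n) (List.nodup_finRange n)
  refine ⟨s, ?_⟩
  have h1 : gammaElt b = ((List.finRange n).map (gen b)).prod := by
    rw [← List.ofFn_eq_map]; rfl
  have h2 : (List.finRange n).toFinset = Finset.univ := by ext; simp
  rw [coprod, h1, hs, h2, Finset.powerset_univ]
  simp [Finset.compl_eq_univ_sdiff]

end Env

/-! ## Traces in the spin representations -/

section Spin

theorem exp_quarter_ne_zero : Complex.exp (Complex.I * Real.pi / 4) ≠ 0 := Complex.exp_ne_zero _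

theorem matX_mul_matY (ζ : ℂ) : matX ζ * matY ζ = (-Complex.I * ζ) • gradMat := by
  ext i j; fin_cases i <;> fin_cases j <;> simp [matX, matY, gradMat, mul_comm]

/-- The grading operator in the slots `s, …, j - 1`. -/
def gradIco (m s j : ℕ) : Matrix (Fin m → Fin 2) (Fin m → Fin 2) ℂ :=
  pureTensor fun l => if s ≤ l.val ∧ l.val < j then gradMat else 1

/-- The two generators of slot `p` extend the string of grading operators by one slot: this is the
induction step of `prod_cGen`. -/
theorem gradIco_mul_oddAt_mul_oddAt {m s p : ℕ} (hs : s ≤ p) (hp : p < m) (ζ : ℂ) :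
    gradIco m s p * (oddAt m s p (matX ζ) * oddAt m s p (matY ζ))
      = (-Complex.I * ζ) • gradIco m s (p + 1) := by
  have h : (fun l : Fin m => (if s ≤ l.val ∧ l.val < p then gradMat else 1) *
      ((if l.val = p then matX ζ else if s ≤ l.val ∧ l.val < p then gradMat else 1) *
      (if l.val = p then matY ζ else if s ≤ l.val ∧ l.val < p then gradMat else 1)))
      = fun l : Fin m => (if l = ⟨p, hp⟩ then -Complex.I * ζ else 1) •
        (if s ≤ l.val ∧ l.val < p + 1 then gradMat else 1) := by
    funext l
    by_cases hl : l.val = p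
    · have h1 : l = ⟨p, hp⟩ := Fin.ext hl
      simp [h1, hs, matX_mul_matY]
    · have h1 : l ≠ ⟨p, hp⟩ := fun h => hl (by rw [h])
      have h2 : l.val < p + 1 ↔ l.val < p := by omega
      simp only [hl, h1, h2, if_false, one_smul]
      split_ifs
      · rw [gradMat_sq, mul_one]
      · simp
  rw [gradIco, oddAt, oddAt, pureTensor_mul, pureTensor_mul, h, pureTensor_smul, gradIco]
  simp

theorem gradIco_self (m s : ℕ) : gradIco m s s = 1 := by
  rw [gradIco, ← pureTensor_one]
  congr 1
  funext l
  rw [if_neg (by omega)]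

/-- The grading operator of `𝒮` for even `n`, and multiplication by `ε` for odd `n`. -/
def topMat (n : ℕ) (ζ : ℂ) : SpinMat n :=
  if Even n then gradIco (half n) 0 (half n) else epsMat n ζ

/-- Each consecutive pair of generators yields `-iζ` and a grading operator in its slot. For odd `n`
the first generator carries `ε` and the full grading of the remaining slots; the latter cancels
against the pairs, leaving `ε`. -/
theorem prod_cGen {n : ℕ} (ζ : ℂ) :
    (List.ofFn (cGen n ζ)).prod = (-Complex.I * ζ) ^ (n / 2) • topMat n ζ := by
  set L := List.ofFn (cGen n ζ) with hL
  have hlen : L.length = n := by simp [hL]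
  have step : ∀ (i : ℕ) (hi : i < n), (L.take (i + 1)).prod = (L.take i).prod * cGen n ζ ⟨i, hi⟩ := by
    intro i hi
    rw [List.prod_take_succ L i (by omega)]
    simp [hL]
  by_cases hn : Even n
  · have key : ∀ j, 2 * j ≤ n →
        (L.take (2 * j)).prod = (-Complex.I * ζ) ^ j • gradIco (half n) 0 j := by
      intro j
      induction j with
      | zero => intro _; simp [gradIco_self]
      | succ j ih =>
        intro hj
        have h1 : half n = n / 2 := by
          obtain ⟨k, hk⟩ := hn
          unfold half; omega
        rw [show 2 * (j + 1) = 2 * j + 1 + 1 by ring, step _ (by omega), step _ (by omega),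
          ih (by omega), mul_assoc, smul_mul_assoc]
        have c1 : cGen n ζ ⟨2 * j, by omega⟩ = oddAt (half n) 0 j (matX ζ) := by
          simp [cGen, hn]
        have c2 : cGen n ζ ⟨2 * j + 1, by omega⟩ = oddAt (half n) 0 j (matY ζ) := by
          have : ¬ Even (2 * j + 1) := by simp
          have h3 : (2 * j + 1) / 2 = j := by omega
          simp only [cGen, hn, this, h3, if_true, if_false]
        rw [c1, c2, gradIco_mul_oddAt_mul_oddAt (Nat.zero_le _) (by omega), smul_smul, pow_succ]
    obtain ⟨k, hk⟩ := id hn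
    have h1 : half n = n / 2 := by unfold half; omega
    have h2 := key (half n) (by omega)
    rw [show 2 * half n = n by omega, List.take_of_length_le hlen.le] at h2
    rw [topMat, if_pos hn, ← h1]
    exact h2
  · obtain ⟨k, hk⟩ := Nat.not_even_iff_odd.1 hn
    have hh : half n = k + 1 := by unfold half; omega
    have hE := epsMat_sq hn ζ
    have hG := chirMat_sq n
    have hEG := epsMat_chirMat n ζ
    -- The unpaired generator comes first, so the partial products have odd length and the gradings
    -- occupy the slots `1, …, j`.
    have key : ∀ j, 2 * j + 1 ≤ n → (L.take (2 * j + 1)).prod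
        = (-Complex.I * ζ) ^ j • (epsMat n ζ * chirMat n * gradIco (half n) 1 (j + 1)) := by
      intro j
      induction j with
      | zero =>
        intro h
        rw [mul_zero, step 0 (by omega)]
        simp [gradIco_self, cGen, hn]
      | succ j ih =>
        intro hj
        rw [show 2 * (j + 1) + 1 = 2 * j + 1 + 1 + 1 by ring, step _ (by omega), step _ (by omega),
          ih (by omega), mul_assoc, smul_mul_assoc]
        have c1 : cGen n ζ ⟨2 * j + 1, by omega⟩ = (-Complex.I) • (epsMat n ζ * chirMat n *
            oddAt (half n) 1 (j + 1) (matX 1)) := by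
          have h1 : ¬ Even (2 * j + 1) := by simp
          have h3 : (2 * j + 1 + 1) / 2 = j + 1 := by omega
          simp only [cGen, hn, h1, h3, if_false, Nat.succ_ne_zero]
        have c2 : cGen n ζ ⟨2 * j + 1 + 1, by omega⟩ = (-Complex.I) • (epsMat n ζ * chirMat n *
            oddAt (half n) 1 (j + 1) (matY 1)) := by
          have h1 : Even (2 * j + 1 + 1) := ⟨j + 1, by ring⟩
          have h3 : (2 * j + 1 + 1 + 1) / 2 = j + 1 := by omega
          simp only [cGen, hn, h1, h3, if_false, if_true, Nat.succ_ne_zero]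
        rw [c1, c2, odd_gen_mul hE hG hEG (epsMat_oddAt (by omega) ζ _)
          (chirMat_oddAt (by omega) (by omega) (matX_grad 1)), mul_smul_comm, mul_assoc,
          gradIco_mul_oddAt_mul_oddAt (by omega) (by omega), mul_smul_comm, smul_smul, smul_smul,
          pow_succ]
        congr 1
        ring
    have h2 := key k (by omega)
    have h3 : chirMat n = gradIco (half n) 1 (k + 1) := by
      rw [chirMat, gradIco]
      congr 1
      funext l
      have := l.isLt
      by_cases hl : l.val = 0
      · simp [hl]
      · rw [if_neg hl, if_pos (by omega)]
    rw [← hk, List.take_of_length_le hlen.le, ← h3, mul_assoc, hG, mul_one] at h2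
    rw [h2, topMat, if_neg hn, show n / 2 = k by omega]

theorem topMat_sq {n : ℕ} (ζ : ℂ) :
    topMat n ζ * topMat n ζ = (if Even n then 1 else ζ) • 1 := by
  by_cases hn : Even n
  · simp only [topMat, hn, if_true, one_smul]
    rw [gradIco, pureTensor_mul, ← pureTensor_one]
    congr 1
    funext l
    simp [gradMat_sq]
  · simp only [topMat, hn, if_false]
    exact epsMat_sq hn ζ

theorem topMat_cGen_of_even {n : ℕ} (hn : Even n) (ζ : ℂ) (i : Fin n) :
    topMat n ζ * cGen n ζ i = -(cGen n ζ i * topMat n ζ) := by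
  have hp : i.val / 2 < half n := by
    have := i.isLt
    obtain ⟨k, hk⟩ := hn
    unfold half; omega
  simp only [topMat, cGen, hn, if_true]
  refine pureTensor_anticomm ⟨i.val / 2, hp⟩ _ _ ?_ fun l hl => ?_
  · simp only [if_true, Nat.zero_le, hp, and_self]
    rw [matXY_grad, neg_neg]
  · have hl' : l.val ≠ i.val / 2 := fun h => hl (Fin.ext h)
    by_cases h : l.val < i.val / 2 <;> simp [hl', h]

theorem epsMat_cGen {n : ℕ} (hn : ¬ Even n) (ζ : ℂ) (i : Fin n) :
    epsMat n ζ * cGen n ζ i = cGen n ζ i * epsMat n ζ := by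
  have hEG := epsMat_chirMat n ζ
  simp only [cGen, hn, if_false]
  split_ifs with h0
  · rw [mul_assoc, ← hEG]
  all_goals
    exact (((Commute.refl _).mul_right hEG).mul_right
      (epsMat_oddAt (by omega) ζ _)).smul_right (-Complex.I)

/-- For odd `n`: the operator `1 ↦ 1`, `ε ↦ -ε` on the tensor factor `D`. -/
def conjMat (n : ℕ) : SpinMat n := pureTensor fun l => if l.val = 0 then gradMat else 1

theorem conjMat_sq (n : ℕ) : conjMat n * conjMat n = 1 := by
  rw [conjMat, pureTensor_mul, ← pureTensor_one]
  congr 1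
  funext l
  by_cases h : l.val = 0 <;> simp [h, gradMat_sq]

theorem conjMat_epsMat {n : ℕ} (hn : ¬ Even n) (ζ : ℂ) :
    conjMat n * epsMat n ζ = -(epsMat n ζ * conjMat n) := by
  have hp : 0 < half n := by
    obtain ⟨k, hk⟩ := Nat.not_even_iff_odd.1 hn
    unfold half; omega
  refine pureTensor_anticomm ⟨0, hp⟩ _ _ ?_ fun l hl => ?_
  · simp [matX_grad]
  · have hl' : l.val ≠ 0 := fun h => hl (Fin.ext h)
    simp [hl']

theorem conjMat_chirMat (n : ℕ) : conjMat n * chirMat n = chirMat n * conjMat n := by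
  refine pureTensor_comm _ _ fun l => ?_
  by_cases h : l.val = 0 <;> simp [h]

theorem conjMat_oddAt {n p : ℕ} (hp : 1 ≤ p) (M : Matrix (Fin 2) (Fin 2) ℂ) :
    conjMat n * oddAt (half n) 1 p M = oddAt (half n) 1 p M * conjMat n := by
  refine pureTensor_comm _ _ fun l => ?_
  by_cases h : l.val = 0
  · have : ¬ (0 = p) := by omega
    simp [h, this]
  · simp [h]

/-- Every generator contains exactly one factor `ε`, so `ε ↦ -ε` reverses its sign. For odd `n` this
operator replaces the grading operator, which is available only for even `n`. -/
theorem conjMat_cGen {n : ℕ} (hn : ¬ Even n) (ζ : ℂ) (i : Fin n) :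
    conjMat n * cGen n ζ i = -(cGen n ζ i * conjMat n) := by
  have h1 : conjMat n * (epsMat n ζ * chirMat n) = -(epsMat n ζ * chirMat n * conjMat n) := by
    rw [← mul_assoc, conjMat_epsMat hn, neg_mul, mul_assoc, conjMat_chirMat, mul_assoc]
  simp only [cGen, hn, if_false]
  split_ifs with h0
  · exact h1
  all_goals
    rw [mul_smul_comm, smul_mul_assoc, ← smul_neg]
    congr 1
    rw [← mul_assoc, h1, neg_mul, mul_assoc (epsMat n ζ * chirMat n), conjMat_oddAt (by omega),
      ← mul_assoc]

/-- Conjugation by the invertible `x` preserves the trace but changes the sign of `N`. -/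
theorem trace_eq_zero_of_anticomm {m : Type*} [Fintype m] [DecidableEq m] {x N : Matrix m m ℂ}
    {c : ℂ} (hc : c ≠ 0) (hx : x * x = c • 1) (h : x * N = -(N * x)) : N.trace = 0 := by
  have h1 : (x * N * x).trace = c * N.trace := by
    rw [Matrix.trace_mul_comm, ← mul_assoc, hx]; simp
  have h2 : (x * N * x).trace = -(c * N.trace) := by
    rw [h, neg_mul, mul_assoc, hx]; simp
  have h3 : c * N.trace = 0 := by
    rw [h1] at h2; linear_combination h2 / 2
  exact (mul_eq_zero.1 h3).resolve_left hc

/-- The functional `T` as a linear map. -/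
def spinTLin (n : ℕ) (ζ : ℂ) : SpinMat n →ₗ[ℂ] ℂ :=
  (if Even n then 1 else Complex.exp (Complex.I * Real.pi / 4)) •
    (Matrix.traceLinearMap (SpinIdx n) ℂ ℂ ∘ₗ LinearMap.mulLeft ℂ (topMat n ζ))

theorem spinTLin_apply (n : ℕ) (ζ : ℂ) (A : SpinMat n) :
    spinTLin n ζ A = (if Even n then 1 else Complex.exp (Complex.I * Real.pi / 4))
      * (topMat n ζ * A).trace := by
  simp only [spinTLin, LinearMap.smul_apply, smul_eq_mul]
  rfl

theorem gradMat_apply (i j : Fin 2) : gradMat i j = if i = j then (-1) ^ i.val else 0 := by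
  fin_cases i <;> fin_cases j <;> simp [gradMat]

/-- The supertrace is the trace against the grading operator, which is diagonal with entries
`(-1)^(∑ s_l)`. Thus both parities take the form of a trace against `topMat`. -/
theorem spinT_eq_spinTLin (n : ℕ) (ζ : ℂ) (A : SpinMat n) : spinT n ζ A = spinTLin n ζ A := by
  rw [spinTLin_apply]
  by_cases hn : Even n
  · simp only [spinT, hn, if_true, one_mul, Matrix.trace, Matrix.diag_apply, Matrix.mul_apply]
    refine Finset.sum_congr rfl fun s _ => ?_
    rw [Finset.sum_eq_single s]
    · congr 1
      simp [topMat, hn, gradIco, pureTensor, gradMat_apply, Finset.prod_pow_eq_pow_sum]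
    · intro t _ hts
      obtain ⟨l, hl⟩ := Function.ne_iff.1 hts
      have h0 : topMat n ζ s t = 0 := by
        simp only [topMat, hn, if_true, gradIco, pureTensor, Matrix.of_apply]
        refine Finset.prod_eq_zero (Finset.mem_univ l) ?_
        simp [gradMat_apply, Ne.symm hl]
      rw [h0, zero_mul]
    · simp
  · simp [spinT, hn, topMat]

section Rep

variable {V : Type*} [NormedAddCommGroup V] [InnerProductSpace ℝ V] {n : ℕ}

theorem spinRep_gen (b : OrthonormalBasis (Fin n) ℝ V) (ζ : ℂ) (i : Fin n) :
    spinRep b ζ (gen b i) = Complex.exp (Complex.I * Real.pi / 4) • cGen n ζ i := by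
  rw [spinRep, gen, lift_ι]
  simp [spinRepLin, cliff, OrthonormalBasis.repr_self]

theorem spinRep_gen_sq (b : OrthonormalBasis (Fin n) ℝ V) (ζ : ℂ) (i : Fin n) :
    spinRep b ζ (gen b i) * spinRep b ζ (gen b i) = (Complex.I * ζ) • 1 := by
  rw [← map_mul, (isCliffordFamily_gen b).sq, spinRep_z]

theorem topMat_spinRep_gen_of_even (hn : Even n) (b : OrthonormalBasis (Fin n) ℝ V) (ζ : ℂ)
    (i : Fin n) : topMat n ζ * spinRep b ζ (gen b i) = -(spinRep b ζ (gen b i) * topMat n ζ) := by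
  rw [spinRep_gen, mul_smul_comm, topMat_cGen_of_even hn, smul_neg, smul_mul_assoc]

theorem epsMat_spinRep_gen (hn : ¬ Even n) (b : OrthonormalBasis (Fin n) ℝ V) (ζ : ℂ)
    (i : Fin n) : epsMat n ζ * spinRep b ζ (gen b i) = spinRep b ζ (gen b i) * epsMat n ζ := by
  rw [spinRep_gen, mul_smul_comm, epsMat_cGen hn, smul_mul_assoc]

theorem conjMat_spinRep_gen (hn : ¬ Even n) (b : OrthonormalBasis (Fin n) ℝ V) (ζ : ℂ)
    (i : Fin n) : conjMat n * spinRep b ζ (gen b i) = -(spinRep b ζ (gen b i) * conjMat n) := by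
  rw [spinRep_gen, mul_smul_comm, conjMat_cGen hn, smul_neg, smul_mul_assoc]

/-- In each case some invertible operator anticommutes with `topMat` times the monomial. For even
`n` it is a generator missing from `K` if `|K|` is even, and the grading operator if `|K|` is odd.
For odd `n`, where `ε` commutes with all generators, it is `conjMat` if `|K|` is even, and a missing
generator if `|K|` is odd. Generators are invertible because `ζ ≠ 0`. -/
theorem spinTLin_spinRep_mon_eq_zero (b : OrthonormalBasis (Fin n) ℝ V) {ζ : ℂ} (hζ : ζ ≠ 0)
    {K : Finset (Fin n)} (hK : K ≠ Finset.univ) : spinTLin n ζ (spinRep b ζ (mon (gen b) K)) = 0 := by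
  have hIζ : Complex.I * ζ ≠ 0 := mul_ne_zero Complex.I_ne_zero hζ
  obtain ⟨i, hi⟩ : ∃ i, i ∉ K := by
    by_contra! h
    exact hK (Finset.eq_univ_of_forall h)
  have hgen := congrArg (spinRep b ζ) (gen_mul_mon_of_notMem (isCliffordFamily_gen b).anticomm hi)
  rw [spinTLin_apply]
  refine mul_eq_zero_of_right _ ?_
  by_cases hn : Even n
  · by_cases hc : Even K.card
    · refine trace_eq_zero_of_anticomm hIζ (spinRep_gen_sq b ζ i) ?_
      rw [hc.neg_one_pow, one_smul, map_mul, map_mul] at hgen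
      rw [← mul_assoc, ← neg_eq_iff_eq_neg.2 (topMat_spinRep_gen_of_even hn b ζ i), neg_mul,
        mul_assoc, hgen, mul_assoc]
    · have h := mul_mon_of_anticomm (fun i => topMat_spinRep_gen_of_even hn b ζ i) K
      rw [(Nat.not_even_iff_odd.1 hc).neg_one_pow, Units.neg_smul, one_smul, ← map_mon] at h
      refine trace_eq_zero_of_anticomm one_ne_zero (x := topMat n ζ)
        (by rw [topMat_sq, if_pos hn]) ?_
      conv_lhs => rw [h, mul_neg, ← mul_assoc]
  · have htop : topMat n ζ = epsMat n ζ := by rw [topMat, if_neg hn]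
    rw [htop]
    by_cases hc : Even K.card
    · have h := mul_mon_of_anticomm (fun i => conjMat_spinRep_gen hn b ζ i) K
      rw [hc.neg_one_pow, one_smul, ← map_mon] at h
      refine trace_eq_zero_of_anticomm one_ne_zero (x := conjMat n)
        (by rw [conjMat_sq, one_smul]) ?_
      rw [← mul_assoc, conjMat_epsMat hn, neg_mul, mul_assoc, h, mul_assoc]
    · refine trace_eq_zero_of_anticomm hIζ (spinRep_gen_sq b ζ i) ?_
      rw [(Nat.not_even_iff_odd.1 hc).neg_one_pow, Units.neg_smul, one_smul, map_neg, map_mul,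
        map_mul] at hgen
      rw [← mul_assoc, ← epsMat_spinRep_gen hn b ζ i, mul_assoc, hgen, mul_neg, mul_assoc]

/-- The image of `γ` is a multiple of `topMat`, so the trace involves only the scalar `topMat^2`.
The pairs of generators give `ζ^(n/2)`, and for odd `n` the relation `ε^2 = ζ` gives one more power:
this explains the normalisation by `[n]`. -/
theorem exists_spinTLin_spinRep_mon_univ (b : OrthonormalBasis (Fin n) ℝ V) :
    ∃ κ : ℂ, κ ≠ 0 ∧ ∀ ζ : ℂ,
      spinTLin n ζ (spinRep b ζ (mon (gen b) Finset.univ)) = κ * ζ ^ half n := by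
  set c := Complex.exp (Complex.I * Real.pi / 4) with hc
  have hc0 : c ≠ 0 := exp_quarter_ne_zero
  refine ⟨(if Even n then 1 else c) * (c ^ n * (-Complex.I) ^ (n / 2) * 2 ^ half n), ?_,
    fun ζ => ?_⟩
  · refine mul_ne_zero (by split_ifs <;> simp [hc0]) (mul_ne_zero (mul_ne_zero
      (pow_ne_zero _ hc0) (pow_ne_zero _ (neg_ne_zero.2 Complex.I_ne_zero)))
      (pow_ne_zero _ two_ne_zero))
  · have h1 : spinRep b ζ (mon (gen b) Finset.univ)
        = (c ^ n * (-Complex.I * ζ) ^ (n / 2)) • topMat n ζ := by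
      rw [map_mon, mon_univ, mul_smul, ← prod_cGen]
      simp only [spinRep_gen]
      rw [← hc, List.ofFn_eq_map, List.ofFn_eq_map]
      have : ∀ L : List (Fin n), (L.map fun i => c • cGen n ζ i).prod
          = c ^ L.length • (L.map (cGen n ζ)).prod := by
        intro L
        induction L with
        | nil => simp
        | cons i L ih =>
          rw [List.map_cons, List.prod_cons, ih, List.map_cons, List.prod_cons, List.length_cons,
            smul_mul_smul_comm, pow_succ']
      rw [this, List.length_finRange]
    rw [h1, map_smul, spinTLin_apply, topMat_sq, Matrix.trace_smul, Matrix.trace_one]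
    have hcard : Fintype.card (SpinIdx n) = 2 ^ half n := by simp
    rw [hcard]
    by_cases hn : Even n
    · have hh : half n = n / 2 := by
        obtain ⟨k, hk⟩ := hn
        unfold half; omega
      simp only [hn, if_true, hh, smul_eq_mul]
      push_cast
      ring
    · have hh : half n = n / 2 + 1 := by
        obtain ⟨k, hk⟩ := Nat.not_even_iff_odd.1 hn
        unfold half; omega
      simp only [hn, if_false, hh, smul_eq_mul]
      push_cast
      ring

theorem spinRep_zElt_pow_mul (b : OrthonormalBasis (Fin n) ℝ V) (ζ : ℂ) (k : ℕ) (u : Env V) :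
    spinRep b ζ (zElt ^ k * u) = (Complex.I * ζ) ^ k • spinRep b ζ u := by
  rw [map_mul, map_pow, spinRep_z, smul_pow, one_pow, smul_mul_assoc, one_mul]

/-- Orthogonality of the monomials with respect to the functional `T`. -/
theorem exists_spinTLin_pairing (b : OrthonormalBasis (Fin n) ℝ V) :
    ∃ κ : Finset (Fin n) → ℂ, (∀ K, κ K ≠ 0) ∧ ∀ ζ : ℂ, ζ ≠ 0 → ∀ I K,
      spinTLin n ζ (spinRep b ζ (mon (gen b) I) * spinRep b ζ (mon (gen b) K))
        = if I = Kᶜ then κ K * ζ ^ half n else 0 := by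
  obtain ⟨κ, hκ, h⟩ := exists_spinTLin_spinRep_mon_univ b
  choose s hs using (isCliffordFamily_gen b).mon_compl_mul_mon
  refine ⟨fun K => ((s K : ℤ) : ℂ) * κ, fun K => mul_ne_zero ?_ hκ, fun ζ hζ I K => ?_⟩
  · exact Int.cast_ne_zero.2 (s K).ne_zero
  · by_cases hI : I = Kᶜ
    · rw [if_pos hI, hI, ← map_mul, hs, Units.smul_def, map_zsmul, map_zsmul, h, zsmul_eq_mul,
        mul_assoc]
    · rw [if_neg hI, ← map_mul]
      obtain ⟨r, hr⟩ := (isCliffordFamily_gen b).mon_mul_mon I K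
      -- Up to sign and powers of `z` the product is the monomial of `I ∆ K`, which is the top one
      -- only for `I = Kᶜ`.
      have hne : symmDiff I K ≠ Finset.univ := by
        intro h
        apply hI
        ext j
        have hj : j ∈ symmDiff I K := h ▸ Finset.mem_univ j
        rw [Finset.mem_symmDiff] at hj
        rw [Finset.mem_compl]
        tauto
      rw [hr, Units.smul_def, map_zsmul, map_zsmul, spinRep_zElt_pow_mul, map_smul,
        spinTLin_spinRep_mon_eq_zero b hζ hne, smul_zero, smul_zero]

/-- Pairing a relation with the monomial of `Kᶜ` isolates the coefficient of `K`. -/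
theorem linearIndependent_spinRep_mon (b : OrthonormalBasis (Fin n) ℝ V) {ζ : ℂ} (hζ : ζ ≠ 0) :
    LinearIndependent ℂ fun K => spinRep b ζ (mon (gen b) K) := by
  obtain ⟨κ, hκ, hp⟩ := exists_spinTLin_pairing b
  rw [Fintype.linearIndependent_iff]
  intro c hc K
  have h := congrArg (fun A => spinTLin n ζ (spinRep b ζ (mon (gen b) Kᶜ) * A)) hc
  simp only [Finset.mul_sum, mul_smul_comm, map_sum, map_smul, hp ζ hζ, mul_zero, map_zero,
    smul_eq_mul, compl_inj_iff, mul_ite] at h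
  rw [Finset.sum_ite_eq, if_pos (Finset.mem_univ _)] at h
  exact (mul_eq_zero.1 h).resolve_right (mul_ne_zero (hκ K) (pow_ne_zero _ hζ))

theorem spinRep_mem_spinEnd (b : OrthonormalBasis (Fin n) ℝ V) (ζ : ℂ) (u : Env V) :
    spinRep b ζ u ∈ spinEnd n ζ := by
  rw [spinEnd]
  split_ifs with hn
  · exact Algebra.mem_top
  induction u using env_induction_mon b with
  | add u v hu hv => rw [map_add]; exact add_mem hu hv
  | smul c u hu =>
    rw [map_smul, ← Complex.coe_smul]
    exact Subalgebra.smul_mem _ hu _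
  | mon k K =>
    rw [spinRep_zElt_pow_mul]
    refine Subalgebra.smul_mem _ ?_ _
    rw [Subalgebra.mem_centralizer_iff]
    rintro _ rfl
    rw [map_mon]
    exact mul_mon_of_comm (epsMat_spinRep_gen hn b ζ) K

theorem finrank_spinMat (n : ℕ) : Module.finrank ℂ (SpinMat n) = 2 ^ half n * 2 ^ half n := by
  rw [Module.finrank_matrix]; simp

/-- For odd `n`, left multiplication by `conjMat` maps the commutant of `ε` injectively into
operators anticommuting with `ε`. The two spaces are disjoint as `ε` is invertible, so the commutant
fills at most half of the `2^(n+1)` dimensions. -/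
theorem finrank_spinEnd_le {ζ : ℂ} (hζ : ζ ≠ 0) :
    Module.finrank ℂ (Subalgebra.toSubmodule (spinEnd n ζ)) ≤ 2 ^ n := by
  by_cases hn : Even n
  · refine (Submodule.finrank_le _).trans_eq ?_
    obtain ⟨k, hk⟩ := hn
    rw [finrank_spinMat, ← pow_add, show half n + half n = n by unfold half; omega]
  · obtain ⟨k, hk⟩ := Nat.not_even_iff_odd.1 hn
    set C := Subalgebra.toSubmodule (spinEnd n ζ) with hC
    have hmem : ∀ M ∈ C, epsMat n ζ * M = M * epsMat n ζ := by
      intro M hM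
      rw [hC, Subalgebra.mem_toSubmodule, spinEnd, if_neg hn, Subalgebra.mem_centralizer_iff] at hM
      exact hM _ rfl
    have hinj : Function.Injective (LinearMap.mulLeft ℂ (conjMat n)) := by
      intro M N h
      have h2 := congrArg (conjMat n * ·) h
      simpa only [LinearMap.mulLeft_apply, ← mul_assoc, conjMat_sq, one_mul] using h2
    have hdisj : Disjoint C (C.map (LinearMap.mulLeft ℂ (conjMat n))) := by
      rw [Submodule.disjoint_def]
      rintro _ hM ⟨N, hN, rfl⟩
      have h1 := hmem _ hM
      have h2 := hmem _ hN
      rw [LinearMap.mulLeft_apply, ← mul_assoc,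
        ← neg_eq_iff_eq_neg.2 (conjMat_epsMat hn ζ), neg_mul, mul_assoc, h2, ← mul_assoc] at h1
      have h0 : (2 : ℂ) • (conjMat n * N * epsMat n ζ) = 0 := by
        rw [two_smul]
        nth_rewrite 1 [← h1]
        exact neg_add_cancel _
      have h3 := congrArg (· * epsMat n ζ) ((smul_eq_zero.1 h0).resolve_left two_ne_zero)
      simp only [mul_assoc, epsMat_sq hn, zero_mul, mul_smul_comm, mul_one] at h3
      exact (smul_eq_zero.1 h3).resolve_left hζ
    have h := Submodule.finrank_add_finrank_le_of_disjoint hdisj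
    rw [(Submodule.equivMapOfInjective _ hinj C).finrank_eq.symm, finrank_spinMat, ← pow_add,
      show half n + half n = n + 1 by unfold half; omega, pow_succ] at h
    omega

/-- The functional `T` detects the elements of `ℋ`. -/
theorem eq_zero_of_spinTLin_eq_zero (b : OrthonormalBasis (Fin n) ℝ V) {ζ : ℂ} (hζ : ζ ≠ 0)
    {A : SpinMat n} (hA : A ∈ spinEnd n ζ)
    (h : ∀ K, spinTLin n ζ (A * spinRep b ζ (mon (gen b) K)) = 0) : A = 0 := by
  obtain ⟨κ, hκ, hp⟩ := exists_spinTLin_pairing b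
  -- There are `2^n` independent monomials in a space of dimension at most `2^n`.
  have hspan : Submodule.span ℂ (Set.range fun K => spinRep b ζ (mon (gen b) K))
      = Subalgebra.toSubmodule (spinEnd n ζ) := by
    refine Submodule.eq_of_le_of_finrank_le ?_ ?_
    · rw [Submodule.span_le]
      rintro _ ⟨K, rfl⟩
      exact spinRep_mem_spinEnd b ζ _
    · rw [finrank_span_eq_card (linearIndependent_spinRep_mon b hζ)]
      simpa using finrank_spinEnd_le hζ
  have hA' : A ∈ Submodule.span ℂ (Set.range fun K => spinRep b ζ (mon (gen b) K)) := by
    rw [hspan]; exact hA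
  obtain ⟨c, rfl⟩ := (Submodule.mem_span_range_iff_exists_fun ℂ).1 hA'
  refine Finset.sum_eq_zero fun K _ => ?_
  have h1 := h Kᶜ
  simp only [Finset.sum_mul, smul_mul_assoc, map_sum, map_smul, hp ζ hζ, compl_compl, smul_eq_mul,
    mul_ite, mul_zero] at h1
  rw [Finset.sum_ite_eq', if_pos (Finset.mem_univ _)] at h1
  rw [(mul_eq_zero.1 h1).resolve_right (mul_ne_zero (hκ _) (pow_ne_zero _ hζ)), zero_smul]

/-- Entrywise holomorphic families of matrices. -/
def EntrywiseDifferentiable (M : ℂ → SpinMat n) : Prop :=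
  ∀ s t, Differentiable ℂ fun ζ => M ζ s t

namespace EntrywiseDifferentiable

variable {M N : ℂ → SpinMat n}

theorem const (A : SpinMat n) : EntrywiseDifferentiable fun _ => A :=
  fun _ _ => differentiable_const _

theorem add (hM : EntrywiseDifferentiable M) (hN : EntrywiseDifferentiable N) :
    EntrywiseDifferentiable fun ζ => M ζ + N ζ :=
  fun s t => (hM s t).add (hN s t)

theorem smul {f : ℂ → ℂ} (hf : Differentiable ℂ f) (hM : EntrywiseDifferentiable M) :
    EntrywiseDifferentiable fun ζ => f ζ • M ζ :=
  fun s t => hf.mul (hM s t)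

theorem mul (hM : EntrywiseDifferentiable M) (hN : EntrywiseDifferentiable N) :
    EntrywiseDifferentiable fun ζ => M ζ * N ζ := by
  intro s t
  simp only [Matrix.mul_apply]
  exact Differentiable.fun_sum fun r _ => (hM s r).mul (hN r t)

theorem pureTensor {M : Fin (half n) → ℂ → Matrix (Fin 2) (Fin 2) ℂ}
    (hM : ∀ l i j, Differentiable ℂ fun ζ => M l ζ i j) :
    EntrywiseDifferentiable (n := n) fun ζ => pureTensor fun l => M l ζ := by
  intro s t
  simp only [HeisenbergClifford.pureTensor, Matrix.of_apply]
  exact Differentiable.fun_finsetProd fun l _ => hM l _ _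

theorem mon {e : ℂ → Fin n → SpinMat n} (he : ∀ i, EntrywiseDifferentiable fun ζ => e ζ i)
    (K : Finset (Fin n)) : EntrywiseDifferentiable fun ζ => mon (e ζ) K := by
  have key : ∀ L : List (Fin n), EntrywiseDifferentiable fun ζ =>
      (L.map fun i => if i ∈ K then e ζ i else 1).prod := by
    intro L
    induction L with
    | nil => simpa using const 1
    | cons i L ih =>
      simp only [List.map_cons, List.prod_cons]
      refine mul ?_ ih
      split_ifs
      · exact he i
      · exact const 1
  exact key _

end EntrywiseDifferentiable

theorem differentiable_matX (i j : Fin 2) : Differentiable ℂ fun ζ => matX ζ i j := by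
  fin_cases i <;> fin_cases j <;> simp [matX]

theorem differentiable_matY (i j : Fin 2) : Differentiable ℂ fun ζ => matY ζ i j := by
  fin_cases i <;> fin_cases j <;> simp [matY]; fun_prop

theorem entrywiseDifferentiable_epsMat (n : ℕ) : EntrywiseDifferentiable (epsMat n) := by
  refine .pureTensor fun l i j => ?_
  split_ifs
  · exact differentiable_matX i j
  · exact differentiable_const _

theorem entrywiseDifferentiable_topMat (n : ℕ) : EntrywiseDifferentiable (topMat n) := by
  unfold topMat
  split_ifs
  · exact .const _
  · exact entrywiseDifferentiable_epsMat n

theorem entrywiseDifferentiable_cGen (i : Fin n) :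
    EntrywiseDifferentiable fun ζ => cGen n ζ i := by
  unfold cGen
  split_ifs
  · refine .pureTensor fun l s t => ?_
    split_ifs
    · exact differentiable_matX s t
    all_goals exact differentiable_const _
  · refine .pureTensor fun l s t => ?_
    split_ifs
    · exact differentiable_matY s t
    all_goals exact differentiable_const _
  · exact (entrywiseDifferentiable_epsMat n).mul (.const _)
  all_goals
    exact .smul (differentiable_const _) (((entrywiseDifferentiable_epsMat n).mul (.const _)).mul
      (.const _))

theorem entrywiseDifferentiable_spinRep (b : OrthonormalBasis (Fin n) ℝ V) (u : Env V) :
    EntrywiseDifferentiable fun ζ => spinRep b ζ u := by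
  induction u using env_induction_mon b with
  | add u v hu hv => simpa only [map_add] using hu.add hv
  | smul c u hu =>
    simp only [map_smul, ← Complex.coe_smul]
    exact hu.smul (differentiable_const _)
  | mon k K =>
    simp only [spinRep_zElt_pow_mul, map_mon]
    refine .smul (by fun_prop) (.mon (fun i => ?_) K)
    simp only [spinRep_gen]
    exact (entrywiseDifferentiable_cGen i).smul (differentiable_const _)

/-! ## Smooth functions as families of smooth functions on the line -/

/-- Apply all spin representations to a relation and pair with the monomial of `Kᶜ`. The
coefficients belonging to `K` become those of a polynomial in `iζ` that vanishes for every `ζ ≠ 0`.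
-/
theorem linearIndependent_env (b : OrthonormalBasis (Fin n) ℝ V) :
    LinearIndependent ℝ fun q : ℕ × Finset (Fin n) => (zElt ^ q.1 * mon (gen b) q.2 : Env V) := by
  obtain ⟨κ, hκ, hp⟩ := exists_spinTLin_pairing b
  rw [linearIndependent_iff]
  intro c hc
  have key : ∀ K (ζ : ℂ), ζ ≠ 0 →
      c.sum (fun q r => if q.2 = K then (r : ℂ) * (Complex.I * ζ) ^ q.1 else 0) = 0 := by
    intro K ζ hζ
    have h := congrArg (fun u => spinTLin n ζ (spinRep b ζ (mon (gen b) Kᶜ) * spinRep b ζ u)) hc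
    have hterm : ∀ q : ℕ × Finset (Fin n), ∀ r : ℝ, spinTLin n ζ (spinRep b ζ (mon (gen b) Kᶜ)
        * spinRep b ζ (r • (zElt ^ q.1 * mon (gen b) q.2)))
        = (if q.2 = K then (r : ℂ) * (Complex.I * ζ) ^ q.1 else 0) * (κ K * ζ ^ half n) := by
      intro q r
      rw [map_smul, spinRep_zElt_pow_mul, ← Complex.coe_smul, mul_smul_comm, mul_smul_comm,
        map_smul, map_smul, hp ζ hζ]
      by_cases hq : q.2 = K
      · simp [hq, mul_assoc]
      · simp [hq, compl_inj_iff, Ne.symm hq]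
    rw [Finsupp.linearCombination_apply, Finsupp.sum] at h
    simp only [map_sum, Finset.mul_sum, hterm, map_zero, mul_zero] at h
    rw [← Finset.sum_mul] at h
    exact (mul_eq_zero.1 h).resolve_right (mul_ne_zero (hκ K) (pow_ne_zero _ hζ))
  ext ⟨k, K⟩
  set P : Polynomial ℂ := c.sum (fun q r => if q.2 = K then Polynomial.monomial q.1 (r : ℂ) else 0)
    with hP
  have hroot : ∀ w : ℂ, w ≠ 0 → P.eval w = 0 := by
    intro w hw
    -- The parameter is chosen so that `z` acts as `iζ = w`.
    have h := key K (-Complex.I * w) (mul_ne_zero (neg_ne_zero.2 Complex.I_ne_zero) hw)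
    have h1 : Complex.I * (-Complex.I * w) = w := by
      rw [← mul_assoc, mul_neg, Complex.I_mul_I, neg_neg, one_mul]
    rw [h1] at h
    rw [hP, ← h, Finsupp.sum, Polynomial.eval_finsetSum, Finsupp.sum]
    refine Finset.sum_congr rfl fun q _ => ?_
    split_ifs <;> simp
  have hP0 : P = 0 := by
    refine Polynomial.eq_zero_of_infinite_isRoot P (Set.Infinite.mono (s := {0}ᶜ) hroot ?_)
    exact (Set.finite_singleton _).infinite_compl
  have hcoeff : P.coeff k = (c (k, K) : ℂ) := by
    rw [hP, Finsupp.sum, Polynomial.finsetSum_coeff, Finset.sum_eq_single (k, K)]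
    · simp
    · rintro ⟨j, J⟩ _ hne
      by_cases hJ : J = K
      · have hj : j ≠ k := fun h => hne (by rw [h, hJ])
        simp [hJ, Polynomial.coeff_monomial, hj]
      · simp [hJ]
    · intro h
      simp [Finsupp.notMem_support_iff.1 h]
  rw [hP0, Polynomial.coeff_zero] at hcoeff
  simpa using hcoeff.symm

/-- The Poincaré--Birkhoff--Witt basis `z^k a_K` of the enveloping algebra. -/
def envBasis (b : OrthonormalBasis (Fin n) ℝ V) :
    Module.Basis (ℕ × Finset (Fin n)) ℝ (Env V) :=
  Module.Basis.mk (linearIndependent_env b) (by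
    intro u _
    induction u using env_induction_mon b with
    | mon k K => exact Submodule.subset_span ⟨(k, K), rfl⟩
    | add u v hu hv => exact add_mem (hu trivial) (hv trivial)
    | smul c u hu => exact Submodule.smul_mem _ _ (hu trivial))

variable {W : Type*} [NormedAddCommGroup W] [NormedSpace ℝ W]

theorem SmoothFn.toFun_zElt_pow_mul (F : SmoothFn V W) (k : ℕ) (u : Env V) :
    F.toFun (zElt ^ k * u) = deriv^[k] (F.toFun u) := by
  induction k with
  | zero => simp
  | succ k ih => rw [pow_succ', mul_assoc, F.z_mul, ih, Function.iterate_succ_apply']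

theorem SmoothFn.ext_mon (b : OrthonormalBasis (Fin n) ℝ V) {F G : SmoothFn V W}
    (h : ∀ K, F.toFun (mon (gen b) K) = G.toFun (mon (gen b) K)) : F = G := by
  ext u : 2
  induction u using env_induction_mon b with
  | mon k K => rw [F.toFun_zElt_pow_mul, G.toFun_zElt_pow_mul, h]
  | add u v hu hv => rw [map_add, map_add, hu, hv]
  | smul c u hu => rw [map_smul, map_smul, hu]

/-- Prescribe the `k`-th derivative of `f K` on the basis element `z^k a_K`; the rule for `z` then
holds on the basis and extends linearly. -/
theorem exists_smoothFn (b : OrthonormalBasis (Fin n) ℝ V) (f : Finset (Fin n) → ℝ → W)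
    (hf : ∀ K, ContDiff ℝ ∞ (f K)) : ∃ F : SmoothFn V W, ∀ K, F.toFun (mon (gen b) K) = f K := by
  set φ : Env V →ₗ[ℝ] (ℝ → W) := (envBasis b).constr ℝ fun q => deriv^[q.1] (f q.2) with hφ
  have hmon : ∀ k K, φ (zElt ^ k * mon (gen b) K) = deriv^[k] (f K) := by
    intro k K
    have h := (envBasis b).constr_basis ℝ (fun q => deriv^[q.1] (f q.2)) (k, K)
    rwa [envBasis, Module.Basis.mk_apply] at h
  have hsm : ∀ u, ContDiff ℝ ∞ (φ u) := by
    intro u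
    induction u using env_induction_mon b with
    | mon k K => rw [hmon]; exact (hf K).iterate_deriv k
    | add u v hu hv => rw [map_add]; exact hu.add hv
    | smul c u hu => rw [map_smul]; exact hu.const_smul c
  refine ⟨⟨φ, hsm, fun u => ?_⟩, fun K => ?_⟩
  · induction u using env_induction_mon b with
    | mon k K => rw [← mul_assoc, ← pow_succ', hmon, hmon, Function.iterate_succ_apply']
    | add u v hu hv =>
      funext x
      rw [mul_add, map_add, map_add, hu, hv, deriv_add ((hsm u).differentiable (by simp) x)
        ((hsm v).differentiable (by simp) x), Pi.add_apply]
    | smul c u hu =>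
      funext x
      rw [mul_smul_comm, map_smul, map_smul, hu,
        deriv_const_smul c ((hsm u).differentiable (by simp) x), Pi.smul_apply]
  · simpa using hmon 0 K

/-- Neither differentiation nor linear combination leads out of the functions supported in `[-a,
a]`. -/
theorem mem_supportedIn_iff (b : OrthonormalBasis (Fin n) ℝ V) {a : ℝ} {F : SmoothFn V ℂ} :
    F ∈ supportedIn V a ↔ ∀ K, tsupport (F.toFun (mon (gen b) K)) ⊆ Set.Icc (-a) a := by
  refine ⟨fun h K => h _, fun h u => ?_⟩
  induction u using env_induction_mon b with
  | mon k K =>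
    rw [F.toFun_zElt_pow_mul]
    exact tsupport_iteratedDeriv_subset (h K) k
  | add u v hu hv =>
    rw [map_add]
    exact (tsupport_add _ _).trans (Set.union_subset hu hv)
  | smul c u hu =>
    rw [map_smul]
    exact (closure_mono (Function.support_const_smul_subset c _)).trans hu

end Rep

end Spin

/-! ## The Fourier--Laplace transform -/

section Fourier

attribute [local instance] Matrix.normedAddCommGroup Matrix.normedSpace

open MeasureTheory Topology Filter

/-! ### Stability of the bounds, and the removable singularity at the origin -/

namespace PaleyWienerBound

variable {a : ℝ} {g h : ℂ → ℂ}

theorem add (hg : PaleyWienerBound a g) (hh : PaleyWienerBound a h) :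
    PaleyWienerBound a fun ζ => g ζ + h ζ := by
  intro N
  obtain ⟨C, hC⟩ := hg N
  obtain ⟨D, hD⟩ := hh N
  refine ⟨C + D, fun ζ => ?_⟩
  calc ‖g ζ + h ζ‖ * (1 + ‖ζ‖) ^ N ≤ (‖g ζ‖ + ‖h ζ‖) * (1 + ‖ζ‖) ^ N := by
        gcongr; exact norm_add_le _ _
    _ ≤ _ := by rw [add_mul, add_mul]; exact add_le_add (hC ζ) (hD ζ)

theorem const_mul (c : ℂ) (hg : PaleyWienerBound a g) : PaleyWienerBound a fun ζ => c * g ζ := by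
  intro N
  obtain ⟨C, hC⟩ := hg N
  refine ⟨‖c‖ * C, fun ζ => ?_⟩
  rw [norm_mul, mul_assoc, mul_assoc]
  exact mul_le_mul_of_nonneg_left (hC ζ) (norm_nonneg c)

theorem pow_mul (k : ℕ) (hg : PaleyWienerBound a g) :
    PaleyWienerBound a fun ζ => ζ ^ k * g ζ := by
  intro N
  obtain ⟨C, hC⟩ := hg (k + N)
  refine ⟨C, fun ζ => le_trans ?_ (hC ζ)⟩
  rw [norm_mul, norm_pow, pow_add, mul_comm (‖ζ‖ ^ k), mul_assoc]
  gcongr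
  linarith

end PaleyWienerBound

/-- Extension across the origin. -/
theorem exists_entire_extension {a : ℝ} {h : ℂ → ℂ} (hd : ∀ ζ ≠ 0, DifferentiableAt ℂ h ζ)
    (hb : ∀ N : ℕ, ∃ C : ℝ, ∀ ζ : ℂ, ζ ≠ 0 →
      ‖h ζ‖ ≤ C * ((1 + ‖ζ‖) ^ N)⁻¹ * Real.exp (a * |ζ.im|)) :
    ∃ g : ℂ → ℂ, Differentiable ℂ g ∧ PaleyWienerBound a g ∧ ∀ ζ ≠ 0, g ζ = h ζ := by
  refine ⟨Function.update h 0 (limUnder (𝓝[≠] 0) h), fun ζ => ?_, fun N => ?_,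
    fun ζ hζ => Function.update_of_ne hζ _ _⟩
  · by_cases hζ : ζ = 0
    · subst hζ
      refine (Complex.differentiableOn_update_limUnder_of_bddAbove
        (Metric.ball_mem_nhds (0 : ℂ) one_pos)
        (fun ζ hζ => (hd ζ hζ.2).differentiableWithinAt) ?_).differentiableAt
        (Metric.ball_mem_nhds (0 : ℂ) one_pos)
      -- The case `N = 0` bounds `h` on the punctured unit disc, which is what Riemann's theorem on
      -- removable singularities requires.
      obtain ⟨C, hC⟩ := hb 0
      refine ⟨|C| * Real.exp |a|, ?_⟩
      rintro _ ⟨ζ, ⟨hζ, hζ0⟩, rfl⟩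
      refine (hC ζ hζ0).trans ?_
      rw [pow_zero, inv_one, mul_one]
      have h1 : |ζ.im| ≤ 1 := by
        rw [mem_ball_zero_iff] at hζ
        exact (Complex.abs_im_le_norm ζ).trans hζ.le
      refine mul_le_mul (le_abs_self C) (Real.exp_le_exp.2 ?_) (Real.exp_nonneg _) (abs_nonneg _)
      calc a * |ζ.im| ≤ |a| * 1 :=
            mul_le_mul (le_abs_self a) h1 (abs_nonneg _) (abs_nonneg _)
        _ = |a| := mul_one _
    · refine (hd ζ hζ).congr_of_eventuallyEq ?_
      filter_upwards [isOpen_ne.mem_nhds hζ] with w hw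
      exact Function.update_of_ne hw _ _
  · obtain ⟨C, hC⟩ := hb N
    set g := Function.update h 0 (limUnder (𝓝[≠] 0) h) with hg
    -- The given constant says nothing at the origin, where the bound reads `‖g 0‖ ≤ C`.
    refine ⟨max C ‖g 0‖, fun ζ => ?_⟩
    by_cases hζ : ζ = 0
    · subst hζ; simp
    · have h1 : g ζ = h ζ := Function.update_of_ne hζ _ _
      have h2 := hC ζ hζ
      rw [mul_right_comm, ← div_eq_mul_inv, le_div_iff₀ (by positivity)] at h2
      rw [h1]
      refine h2.trans ?_
      gcongr
      exact le_max_left _ _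

/-! ### The transform in terms of its scalar components -/

variable {V : Type*} [NormedAddCommGroup V] [InnerProductSpace ℝ V] {n : ℕ}

/-- The Fourier--Laplace transform in terms of the transforms of the components. -/
theorem exists_fourierLaplace_eq (b : OrthonormalBasis (Fin n) ℝ V) :
    ∃ σ : Finset (Fin n) → ℂ, (∀ I, σ I ≠ 0) ∧ ∀ (a : ℝ) (F : SmoothFn V ℂ), F ∈ supportedIn V a →
      ∀ ζ, fourierLaplace b F ζ = ∑ I, (σ I * laplace (F.toFun (mon (gen b) I)) ζ) •
        spinRep b (-ζ) (mon (gen b) Iᶜ) := by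
  obtain ⟨s, hs⟩ := coprod_gammaElt b
  refine ⟨fun I => ((s I : ℤ) : ℂ), fun I => Int.cast_ne_zero.2 (s I).ne_zero,
    fun a F hF ζ => ?_⟩
  have hterm : ∀ x : ℝ, (mulEven F (spinFn b (-ζ))).toFun (gammaElt b) x = ∑ I,
      (((s I : ℤ) : ℂ) * (F.toFun (mon (gen b) I) x * Complex.exp (Complex.I * -ζ * x))) •
        spinRep b (-ζ) (mon (gen b) Iᶜ) := by
    intro x
    rw [mulEven_apply, hs, map_sum, Finset.sum_apply]
    refine Finset.sum_congr rfl fun I _ => ?_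
    rw [Units.smul_def, map_zsmul, Pi.smul_apply, pairMap_tmul, mul_smul, mul_smul,
      Int.cast_smul_eq_zsmul]
    rfl
  rw [fourierLaplace, superIntegral]
  simp only [hterm]
  have hint : ∀ I, Integrable fun x : ℝ =>
      ((s I : ℤ) : ℂ) * (F.toFun (mon (gen b) I) x * Complex.exp (Complex.I * -ζ * x)) :=
    fun I => (integrable_laplace (F.smooth _).continuous (hF _) ζ).const_mul _
  rw [integral_finsetSum _ fun I _ => (hint I).smul_const _]
  refine Finset.sum_congr rfl fun I _ => ?_
  rw [integral_smul_const, integral_const_mul, laplace]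

/-- Orthogonality leaves only the term `I = K` of the expansion. The constants do not depend on `F`,
so they can be divided out when `F` is constructed from `A`. -/
theorem exists_spinTLin_fourierLaplace (b : OrthonormalBasis (Fin n) ℝ V) :
    ∃ κ : Finset (Fin n) → ℂ, (∀ K, κ K ≠ 0) ∧ ∀ (a : ℝ) (F : SmoothFn V ℂ), F ∈ supportedIn V a →
      ∀ ζ ≠ 0, ∀ K, spinTLin n (-ζ) (fourierLaplace b F ζ * spinRep b (-ζ) (mon (gen b) K))
        = ζ ^ half n * (κ K * laplace (F.toFun (mon (gen b) K)) ζ) := by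
  obtain ⟨σ, hσ, h⟩ := exists_fourierLaplace_eq b
  obtain ⟨κ, hκ, hp⟩ := exists_spinTLin_pairing b
  -- The sign arises because the pairing at parameter `-ζ` produces `(-ζ)^[n]`.
  refine ⟨fun K => σ K * κ K * (-1) ^ half n, fun K => mul_ne_zero (mul_ne_zero (hσ K) (hκ K))
    (pow_ne_zero _ (neg_ne_zero.2 one_ne_zero)), fun a F hF ζ hζ K => ?_⟩
  rw [h a F hF]
  simp only [Finset.sum_mul, smul_mul_assoc, map_sum, map_smul, hp (-ζ) (neg_ne_zero.2 hζ),
    smul_eq_mul, compl_inj_iff, mul_ite, mul_zero]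
  rw [Finset.sum_ite_eq', if_pos (Finset.mem_univ _), neg_pow ζ]
  ring

theorem fourierLaplace_mem_spinEnd (b : OrthonormalBasis (Fin n) ℝ V) {a : ℝ} {F : SmoothFn V ℂ}
    (hF : F ∈ supportedIn V a) (ζ : ℂ) : fourierLaplace b F ζ ∈ spinEnd n (-ζ) := by
  obtain ⟨σ, -, h⟩ := exists_fourierLaplace_eq b
  rw [h a F hF]
  exact sum_mem fun I _ => Subalgebra.smul_mem _ (spinRep_mem_spinEnd b _ _) _

theorem EntrywiseDifferentiable.differentiable {A : ℂ → SpinMat n}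
    (hA : EntrywiseDifferentiable A) : Differentiable ℂ A :=
  differentiable_pi.2 fun s => differentiable_pi.2 fun t => hA s t

theorem entrywiseDifferentiable_of_differentiable {A : ℂ → SpinMat n} (hA : Differentiable ℂ A) :
    EntrywiseDifferentiable A :=
  fun s t => differentiable_pi.1 (differentiable_pi.1 hA s) t

theorem EntrywiseDifferentiable.comp_neg {A : ℂ → SpinMat n} (hA : EntrywiseDifferentiable A) :
    EntrywiseDifferentiable fun ζ => A (-ζ) :=
  fun s t => (hA s t).comp differentiable_neg

theorem differentiable_fourierLaplace (b : OrthonormalBasis (Fin n) ℝ V) {a : ℝ}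
    {F : SmoothFn V ℂ} (hF : F ∈ supportedIn V a) : Differentiable ℂ (fourierLaplace b F) := by
  obtain ⟨σ, -, h⟩ := exists_fourierLaplace_eq b
  rw [funext (h a F hF)]
  refine Differentiable.fun_sum fun I _ => EntrywiseDifferentiable.differentiable ?_
  exact (entrywiseDifferentiable_spinRep b _).comp_neg.smul
    ((differentiable_laplace (F.smooth _).continuous (hF _)).const_mul _)

/-! ### Image, injectivity and surjectivity -/

theorem mapsTo_fourierLaplace (b : OrthonormalBasis (Fin n) ℝ V) (a : ℝ) :
    Set.MapsTo (fourierLaplace b) (supportedIn V a) (exponentialType b a) := by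
  intro F hF
  refine ⟨fourierLaplace_mem_spinEnd b hF, differentiable_fourierLaplace b hF, ?_⟩
  obtain ⟨κ, -, hκ⟩ := exists_spinTLin_fourierLaplace b
  have key : ∀ u : Env V, ∃ g : ℂ → ℂ, PaleyWienerBound a g ∧ ∀ ζ ≠ 0,
      spinTLin n (-ζ) (fourierLaplace b F ζ * spinRep b (-ζ) u) = ζ ^ half n * g ζ := by
    intro u
    induction u using env_induction_mon b with
    | mon k K =>
      -- `z^k` acts as `(-iζ)^k` at parameter `-ζ`; polynomial factors are absorbed by the rapid
      -- decay.
      refine ⟨fun ζ => (-Complex.I) ^ k *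
        (ζ ^ k * (κ K * laplace (F.toFun (mon (gen b) K)) ζ)), ?_, fun ζ hζ => ?_⟩
      · exact (((paleyWienerBound_laplace (F.smooth _) (hF _)).const_mul _).pow_mul k).const_mul _
      · rw [spinRep_zElt_pow_mul, mul_smul_comm, map_smul, hκ a F hF ζ hζ, smul_eq_mul, mul_neg,
          ← neg_mul, mul_pow]
        ring
    | add u v hu hv =>
      obtain ⟨g, hg, hg'⟩ := hu
      obtain ⟨h, hh, hh'⟩ := hv
      refine ⟨_, hg.add hh, fun ζ hζ => ?_⟩
      rw [map_add, mul_add, map_add, hg' ζ hζ, hh' ζ hζ, mul_add]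
    | smul c u hu =>
      obtain ⟨g, hg, hg'⟩ := hu
      refine ⟨_, hg.const_mul c, fun ζ hζ => ?_⟩
      rw [map_smul, ← Complex.coe_smul, mul_smul_comm, map_smul, hg' ζ hζ, smul_eq_mul,
        mul_left_comm]
  intro u N
  obtain ⟨g, hg, hg'⟩ := key u
  obtain ⟨C, hC⟩ := hg N
  refine ⟨C, fun ζ hζ => ?_⟩
  rw [spinT_eq_spinTLin, hg' ζ hζ, inv_mul_cancel_left₀ (pow_ne_zero _ hζ), mul_right_comm,
    ← div_eq_mul_inv, le_div_iff₀ (by positivity)]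
  exact hC ζ

theorem injOn_fourierLaplace (b : OrthonormalBasis (Fin n) ℝ V) (a : ℝ) :
    Set.InjOn (fourierLaplace b) (supportedIn V a) := by
  intro F hF G hG hFG
  obtain ⟨κ, hκ0, hκ⟩ := exists_spinTLin_fourierLaplace b
  refine SmoothFn.ext_mon b fun K => ?_
  have hl : laplace (F.toFun (mon (gen b) K)) = laplace (G.toFun (mon (gen b) K)) := by
    -- The pairing determines the scalar transforms off the origin only; continuity supplies the
    -- missing point.
    refine Continuous.ext_on (dense_compl_singleton (0 : ℂ))
      (differentiable_laplace (F.smooth _).continuous (hF _)).continuous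
      (differentiable_laplace (G.smooth _).continuous (hG _)).continuous fun ζ hζ => ?_
    have h := hκ a F hF ζ hζ K
    rw [hFG, hκ a G hG ζ hζ K] at h
    exact (mul_left_cancel₀ (hκ0 K) (mul_left_cancel₀ (pow_ne_zero _ hζ) h)).symm
  rw [← invLaplace_laplace (F.smooth _) (hF _), hl, invLaplace_laplace (G.smooth _) (hG _)]

theorem surjOn_fourierLaplace (b : OrthonormalBasis (Fin n) ℝ V) (a : ℝ) :
    Set.SurjOn (fourierLaplace b) (supportedIn V a) (exponentialType b a) := by
  rintro A ⟨hA, hAd, hAb⟩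
  obtain ⟨κ, hκ0, hκ⟩ := exists_spinTLin_fourierLaplace b
  have hT : ∀ K, Differentiable ℂ fun ζ =>
      spinTLin n (-ζ) (A ζ * spinRep b (-ζ) (mon (gen b) K)) := by
    intro K
    have h : EntrywiseDifferentiable fun ζ =>
        topMat n (-ζ) * (A ζ * spinRep b (-ζ) (mon (gen b) K)) :=
      (entrywiseDifferentiable_topMat n).comp_neg.mul
        ((entrywiseDifferentiable_of_differentiable hAd).mul
          (entrywiseDifferentiable_spinRep b _).comp_neg)
    simp only [spinTLin_apply, Matrix.trace, Matrix.diag_apply]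
    exact (Differentiable.fun_sum fun s _ => h s s).const_mul _
  -- Up to `κ K`, these are the transforms that the components of a preimage must have.
  choose g hgd hgb hg using fun K => exists_entire_extension (a := a)
    (h := fun ζ => (ζ ^ half n)⁻¹ * spinTLin n (-ζ) (A ζ * spinRep b (-ζ) (mon (gen b) K)))
    (fun ζ hζ => ((differentiableAt_id.pow _).inv (pow_ne_zero _ hζ)).mul (hT K ζ))
    (fun N => by simpa only [spinT_eq_spinTLin] using hAb (mon (gen b) K) N)
  have hcd : ∀ K, Differentiable ℂ fun ζ => (κ K)⁻¹ * g K ζ := fun K => (hgd K).const_mul _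
  have hcb : ∀ K, PaleyWienerBound a fun ζ => (κ K)⁻¹ * g K ζ := fun K => (hgb K).const_mul _
  obtain ⟨F, hF⟩ := exists_smoothFn b (fun K => invLaplace fun ζ => (κ K)⁻¹ * g K ζ)
    fun K => (hcb K).contDiff_invLaplace (hcd K)
  have hFs : F ∈ supportedIn V a := by
    rw [mem_supportedIn_iff b]
    intro K
    rw [hF]
    exact (hcb K).tsupport_invLaplace (hcd K)
  -- `T` detects elements of `ℋ` for `ζ ≠ 0`, so the two sides agree there; the origin follows by
  -- continuity.
  refine ⟨F, hFs, Continuous.ext_on (dense_compl_singleton (0 : ℂ))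
    (differentiable_fourierLaplace b hFs).continuous hAd.continuous fun ζ hζ => ?_⟩
  refine sub_eq_zero.1 (eq_zero_of_spinTLin_eq_zero b (neg_ne_zero.2 hζ)
    (sub_mem (fourierLaplace_mem_spinEnd b hFs ζ) (hA ζ)) fun K => ?_)
  rw [sub_mul, map_sub, hκ a F hFs ζ hζ, hF, (hcb K).laplace_invLaplace (hcd K),
    mul_inv_cancel_left₀ (hκ0 K), hg K ζ hζ, mul_inv_cancel_left₀ (pow_ne_zero _ hζ), sub_self]

end Fourier

end HeisenbergClifford

end

/-- The Paley--Wiener--Schwartz theorem for Heisenberg--Clifford supergroups. -/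
theorem mainTheorem3 {V : Type*} [NormedAddCommGroup V] [InnerProductSpace ℝ V] {n : ℕ}
    (b : OrthonormalBasis (Fin n) ℝ V) (a : ℝ) (ha : 0 < a) :
    Set.BijOn (HeisenbergClifford.fourierLaplace b)
      (HeisenbergClifford.supportedIn V a)
      (HeisenbergClifford.exponentialType b a) :=
  ⟨HeisenbergClifford.mapsTo_fourierLaplace b a, HeisenbergClifford.injOn_fourierLaplace b a,
    HeisenbergClifford.surjOn_fourierLaplace b a⟩
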